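/- **Problem.** Consider $$\min_{x\in\mathbb R^n} f_0(x):=g(x)+h(x)\quad\text{s.t. } c(x)=0,\qquad c=(c_1,\dots,c_l):\mathbb R^n\to\mathbb R^l .$$ Here $g$ is $L_0$-smooth (differentiable with $L_0$-Lipschitz gradient on $\mathbb R^n$) and $\rho_0$-weakly convex ($g+\frac{\rho_0}{2}\|\cdot\|^2$ is convex), each $c_i$ is $L_i$-smooth and $\rho_i$-weakly convex, and $h$ is a proper closed convex function with compact domain $\mathrm{dom}(h)$. All these constants are nonnegative. Put $\partial f_0=\nabla g+\partial h$. For $\varepsilon>0$, a point $x$ is an $\varepsilon$-KKT point if for some $y\in\mathbb R^l$, $\|c(x)\|\le\varepsilon$ and $\mathrm{dist}(0,\partial f_0(x)+J_c(x)^\top y)\le\varepsilon$ (with $\mathrm{dist}(\cdot,\emptyset)=\infty$). Let $B_1,\dots,B_l$ be numbers that satisfy the bounds stated in (a) or (b) below, and put $\bar L=(\sum_i L_i^2)^{1/2}$, $\rho_c=\sum_i B_i\rho_i$, $L_c=\sum_i (B_iL_i+B_i^2)$, $\mathcal L_\beta(x,y)=f_0(x)+y^\top c(x)+\frac\beta2\|c(x)\|^2$.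 **Algorithms.** * $\mathrm{APG}(G,h,\mu,L_G,\delta)$: choose $\bar x^{-1}\in\mathrm{dom}(h)$, put $\alpha=\sqrt{\mu/L_G}$ and $\bar x^0=x^0=\arg\min_x\langle\nabla G(\bar x^{-1}),x\rangle+\frac{L_G}{2}\|x-\bar x^{-1}\|^2+h(x)$. In iteration $t=0,1,\dots$ put $x^{t+1}=\arg\min_x\langle\nabla G(\bar x^t),x\rangle+\frac{L_G}{2}\|x-\bar x^t\|^2+h(x)$ and $\bar x^{t+1}=x^{t+1}+\frac{1-\alpha}{1+\alpha}(x^{t+1}-x^t)$; stop and return $x^{t+1}$ if $\mathrm{dist}(-\nabla G(x^{t+1}),\partial h(x^{t+1}))\le\delta$. * $\mathrm{iPPM}(\phi,h,x^0,\rho,L_\phi,\varepsilon)$: for $j=0,1,\dots$ let $x^{j+1}$ be the output of $\mathrm{APG}(\phi+\rho\|\cdot-x^j\|^2,h,\rho,L_\phi+2\rho,\frac\varepsilon4)$; return $x^{j+1}$ if $2\rho\|x^{j+1}-x^j\|\le\frac\varepsilon2$. * iALM: given $x^0\in\mathrm{dom}(h)$, $y^0=0$, $\beta_0>0$, $\sigma>1$,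 $M>0$ and an integer $q\ge0$, for $k=0,1,\dots$ let $\beta_k=\beta_0\sigma^k$, $\hat\rho_k=\rho_0+\bar L\|y^k\|+\beta_k\rho_c$, $\hat L_k=L_0+\bar L\|y^k\|+\beta_kL_c$, let $x^{k+1}$ be the output of $\mathrm{iPPM}(\mathcal L_{\beta_k}(\cdot,y^k)-h,\,h,\,x^k,\hat\rho_k,\hat L_k,\varepsilon)$, and $y^{k+1}=y^k+w_kc(x^{k+1})$ with $$w_k=\frac{M(k+1)^q}{\|c(x^{k+1})\|}$$ (if $c(x^{k+1})=0$, then $y^{k+1}=y^k$). Assume $\rho_0+\beta_0\rho_c>0$, and fix $v>0$. **Theorem.** The multipliers grow at most polynomially: there is a constant $C$ with $\|y^k\|\le Ck^{q+1}$ for all $k$, for every $\varepsilon$, every $x^0$ and every choice of the points $\bar x^{-1}$. Moreover, given $F\in\mathbb R$, there are constants $C,p$, depending only on the problem, the constants above, $\beta_0,\sigma,M,q,v$ and $F$, such that the following holds for every $\varepsilon>0$, every $x^0\in\mathrm{dom}(h)$ with $f_0(x^0)\le F$ and every choice of the points $\bar x^{-1}\in\mathrm{dom}(h)$ in the calls of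 APG for which the iterates of iALM satisfy the regularity condition $$v\|c(x^k)\|\le\mathrm{dist}\Big(-J_c(x^k)^\top c(x^k),\ \frac{\partial h(x^k)}{\beta_{k-1}}\Big)\qquad\text{for all } k\ge1 .$$ * **(a) General constraints.** Suppose that also every $-c_i$ is $\rho_i$-weakly convex (for example $\rho_i=L_i$), and that $|c_i|\le B_i$ and $\|\nabla c_i\|\le B_i$ on $\{2u-u':u,u'\in\mathrm{dom}(h)\}$. Then all calls of the subroutines that are needed terminate, and iALM produces an $\varepsilon$-KKT point $x^K$, $K\ge1$, within a total of $C(1+\varepsilon^{-3})(1+|\log\varepsilon|)^p$ APG iterations, i.e. $\tilde O(\varepsilon^{-3})$. * **(b) Affine constraints.** Suppose that $c(x)=Ax-b$, $\rho_i=0$ for all $i$, and that $|c_i|\le B_i$ and $\|\nabla c_i\|\le B_i$ on $\mathrm{dom}(h)$. Then the same holds with $C(1+\varepsilon^{-5/2})(1+|\log\varepsilon|)^p$, i.e. $\tilde O(\varepsilon^{-5/2})$ APG iterations. -/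

import Mathlib

open scoped Pointwise

noncomputable section

namespace IALM

/-- `ℝ^n` with the Euclidean norm. -/
abbrev Vec (n : ℕ) : Type := EuclideanSpace ℝ (Fin n)

/-- `f` is differentiable with an `L`-Lipschitz gradient on the whole space. -/
def IsLSmooth {n : ℕ} (L : ℝ) (f : Vec n → ℝ) : Prop :=
  Differentiable ℝ f ∧ ∀ x z, ‖gradient f x - gradient f z‖ ≤ L * ‖x - z‖

/-- `f + (ρ/2)‖·‖²` is convex. -/
def IsWeaklyConvex {n : ℕ} (ρ : ℝ) (f : Vec n → ℝ) : Prop :=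
  ConvexOn ℝ Set.univ (fun x => f x + ρ / 2 * ‖x‖ ^ 2)

/-- Data of the problem `min g(x) + h(x)` subject to `c(x) = 0`. The extended-valued function `h`
is given by its effective domain `dom` and its (finite) values there: it is `+∞` off `dom`,
and the values of `h` off `dom` are never used. -/
structure Problem (n l : ℕ) where
  g : Vec n → ℝ
  h : Vec n → ℝ
  dom : Set (Vec n)
  c : Vec n → Vec l

/-- The constants known to the algorithm: `L₀, ρ₀` for `g`, and `L_i, ρ_i, B_i` for `c_i`. -/
structure Constants (l : ℕ) where
  L₀ : ℝ
  ρ₀ : ℝ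
  L : Fin l → ℝ
  ρ : Fin l → ℝ
  B : Fin l → ℝ

namespace Constants

variable {l : ℕ} (κ : Constants l)

/-- `L̄ = (∑ L_i²)^{1/2}`. -/
def Lbar : ℝ := Real.sqrt (∑ i, κ.L i ^ 2)

/-- `ρ_c = ∑ B_i ρ_i`. -/
def ρc : ℝ := ∑ i, κ.B i * κ.ρ i

/-- `L_c = ∑ (B_i L_i + B_i²)`. -/
def Lc : ℝ := ∑ i, (κ.B i * κ.L i + κ.B i ^ 2)

/-- `ρ̂ = ρ₀ + L̄‖y‖ + β ρ_c`. -/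
def ρhat (β : ℝ) (y : Vec l) : ℝ := κ.ρ₀ + κ.Lbar * ‖y‖ + β * κ.ρc

/-- `L̂ = L₀ + L̄‖y‖ + β L_c`. -/
def Lhat (β : ℝ) (y : Vec l) : ℝ := κ.L₀ + κ.Lbar * ‖y‖ + β * κ.Lc

end Constants

namespace Problem

variable {n l : ℕ} (P : Problem n l)

/-- The standing assumptions: smoothness and weak convexity of `g` and of every `c_i`;
`h` is closed, convex and proper with compact effective domain. (On a compact domain, closedness
of `h` is lower semicontinuity of its restriction to the domain.) -/
structure Standing (κ : Constants l) : Prop where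
  L₀_nonneg : 0 ≤ κ.L₀
  ρ₀_nonneg : 0 ≤ κ.ρ₀
  L_nonneg : ∀ i, 0 ≤ κ.L i
  ρ_nonneg : ∀ i, 0 ≤ κ.ρ i
  g_smooth : IsLSmooth κ.L₀ P.g
  g_weak : IsWeaklyConvex κ.ρ₀ P.g
  c_smooth : ∀ i, IsLSmooth (κ.L i) (fun x => P.c x i)
  c_weak : ∀ i, IsWeaklyConvex (κ.ρ i) (fun x => P.c x i)
  dom_nonempty : P.dom.Nonempty
  dom_compact : IsCompact P.dom
  h_convex : ConvexOn ℝ P.dom P.h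
  h_lsc : LowerSemicontinuousOn P.h P.dom

/-- `B_i` is an upper bound on `S` for `|c_i|` and `‖∇c_i‖`, for every `i`. -/
def BoundsOn (κ : Constants l) (S : Set (Vec n)) : Prop :=
  ∀ i, ∀ x ∈ S, |P.c x i| ≤ κ.B i ∧ ‖gradient (fun z => P.c z i) x‖ ≤ κ.B i

/-- All points `u + (u - u')` with `u, u' ∈ dom h`. For convex `dom h` this is a convex set, and it
contains `u + s (u - u')` for all `s ∈ [0, 1]`, i.e. all possible extrapolated points. -/
def extrapolated : Set (Vec n) := {x | ∃ u ∈ P.dom, ∃ u' ∈ P.dom, x = u + (u - u')}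

/-- The subdifferential `∂h(x)` of the convex function `h` (empty if `x ∉ dom h`). -/
def subdiffH (x : Vec n) : Set (Vec n) :=
  {ξ | x ∈ P.dom ∧ ∀ z ∈ P.dom, P.h x + inner ℝ ξ (z - x) ≤ P.h z}

/-- `∂f₀(x) = ∇g(x) + ∂h(x)`. -/
def subdiffF (x : Vec n) : Set (Vec n) := {gradient P.g x} + P.subdiffH x

/-- `J_c(x)ᵀ y`. -/
def jacT (x : Vec n) (y : Vec l) : Vec n := ContinuousLinearMap.adjoint (fderiv ℝ P.c x) y

/-- `x` is an `ε`-KKT point. The distance to the empty set is `∞`. -/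
def IsKKT (ε : ℝ) (x : Vec n) : Prop :=
  ∃ y : Vec l, ‖P.c x‖ ≤ ε ∧
    Metric.infEDist 0 (P.subdiffF x + {P.jacT x y}) ≤ ENNReal.ofReal ε

/-- The smooth part `L_β(·, y) - h` of the augmented Lagrangian. -/
def smoothAL (β : ℝ) (y : Vec l) (x : Vec n) : ℝ :=
  P.g x + inner ℝ y (P.c x) + β / 2 * ‖P.c x‖ ^ 2

/-- The regularity inequality at `x`: `v‖c(x)‖ ≤ dist(-J_c(x)ᵀc(x), ∂h(x)/β)`. -/
def RegularAt (v β : ℝ) (x : Vec n) : Prop :=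
  ENNReal.ofReal (v * ‖P.c x‖) ≤
    Metric.infEDist (-(P.jacT x (P.c x))) (β⁻¹ • P.subdiffH x)

/-- `x` minimises `⟨∇G(w), ·⟩ + (LG/2)‖· - w‖² + h`. -/
def IsProxGradStep (G : Vec n → ℝ) (LG : ℝ) (w x : Vec n) : Prop :=
  x ∈ P.dom ∧ ∀ z ∈ P.dom,
    inner ℝ (gradient G w) x + LG / 2 * ‖x - w‖ ^ 2 + P.h x ≤
      inner ℝ (gradient G w) z + LG / 2 * ‖z - w‖ ^ 2 + P.h z

/-- The stopping test `dist(-∇G(x), ∂h(x)) ≤ δ` of APG. -/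
def APGStop (G : Vec n → ℝ) (δ : ℝ) (x : Vec n) : Prop :=
  Metric.infEDist (-(gradient G x)) (P.subdiffH x) ≤ ENNReal.ofReal δ

/-- `APG(G, h, μ, LG, δ)` started with `x̄^{-1} = start` stops after exactly `T` iterations of its
loop and outputs `out`. Here `u t` is `x^t` and `w t` is `x̄^t`. -/
def APGOutputs (G : Vec n → ℝ) (μ LG δ : ℝ) (start : Vec n) (T : ℕ) (out : Vec n) : Prop :=
  ∃ u w : ℕ → Vec n,
    P.IsProxGradStep G LG start (u 0) ∧ w 0 = u 0 ∧
    (∀ t < T, P.IsProxGradStep G LG (w t) (u (t + 1)) ∧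
      w (t + 1) = u (t + 1) +
        ((1 - Real.sqrt (μ / LG)) / (1 + Real.sqrt (μ / LG))) • (u (t + 1) - u t)) ∧
    0 < T ∧ P.APGStop G δ (u T) ∧ (∀ t, 0 < t → t < T → ¬ P.APGStop G δ (u t)) ∧
    out = u T

/-- `iPPM(φ, h, x₀, ρ, Lφ, ε)` stops and outputs `out`, after a total of `N` APG iterations. The
`j`-th call of APG starts at `start j`. Here `z j` is the `j`-th iterate and `T j` is the number of
iterations of the `j`-th APG call; the loop returns in its iteration number `S`. -/
def IPPMOutputs (φ : Vec n → ℝ) (x₀ : Vec n) (ρ Lφ ε : ℝ) (start : ℕ → Vec n)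
    (N : ℕ) (out : Vec n) : Prop :=
  ∃ (S : ℕ) (z : ℕ → Vec n) (T : ℕ → ℕ),
    z 0 = x₀ ∧
    (∀ j ≤ S, P.APGOutputs (fun x => φ x + ρ * ‖x - z j‖ ^ 2) ρ (Lφ + 2 * ρ) (ε / 4)
      (start j) (T j) (z (j + 1))) ∧
    (∀ j < S, ¬ (2 * ρ * ‖z (j + 1) - z j‖ ≤ ε / 2)) ∧
    2 * ρ * ‖z (S + 1) - z S‖ ≤ ε / 2 ∧
    out = z (S + 1) ∧ N = ∑ j ∈ Finset.range (S + 1), T j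

end Problem

/-- Parameters of the outer algorithm: initial penalty, growth factor, and the two
parameters of the dual step sizes `w_k = M (k+1)^q / ‖c(x^{k+1})‖`. -/
structure Params where
  β₀ : ℝ
  σ : ℝ
  M : ℝ
  q : ℕ

/-- `β_k = β₀ σ^k`. -/
def Params.β (a : Params) (k : ℕ) : ℝ := a.β₀ * a.σ ^ k

/-- The first `K` outer iterations of the inexact augmented Lagrangian method with tolerance `ε`,
started at `x₀`, run to completion with primal iterates `x`, multipliers `y`, and `N k` APG
iterations in outer iteration `k`. The `j`-th APG call in outer iteration `k` starts
at `start k j`. If `c(x^{k+1}) = 0` then the step size is irrelevant, and `y^{k+1} = y^k`. -/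
structure IsRun {n l : ℕ} (P : Problem n l) (κ : Constants l) (a : Params) (ε : ℝ) (x₀ : Vec n)
    (start : ℕ → ℕ → Vec n) (K : ℕ) (x : ℕ → Vec n) (y : ℕ → Vec l) (N : ℕ → ℕ) : Prop where
  x_zero : x 0 = x₀
  y_zero : y 0 = 0
  x_step : ∀ k < K, P.IPPMOutputs (P.smoothAL (a.β k) (y k)) (x k)
    (κ.ρhat (a.β k) (y k)) (κ.Lhat (a.β k) (y k)) ε (start k) (N k) (x (k + 1))
  y_step : ∀ k < K, y (k + 1) =
    y k + (a.M * ((k : ℝ) + 1) ^ a.q / ‖P.c (x (k + 1))‖) • P.c (x (k + 1))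

/-- The regularity condition with constant `v`: it holds at every primal iterate `x^k`, `k ≥ 1`,
that the method produces from the given data, with the penalty `β_{k-1}`. -/
def RegularAlong {n l : ℕ} (P : Problem n l) (κ : Constants l) (a : Params) (ε : ℝ) (x₀ : Vec n)
    (start : ℕ → ℕ → Vec n) (v : ℝ) : Prop :=
  ∀ K x y N, IsRun P κ a ε x₀ start K x y N →
    ∀ k < K, P.RegularAt v (a.β k) (x (k + 1))

/-- The method produces an `ε`-KKT point within `bound` APG iterations: for some `K`, all subroutine
calls of the first `K` outer iterations terminate, these use at most `bound` APG
iterations in total, and `x^K` is an `ε`-KKT point. -/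
def ProducesKKTWithin {n l : ℕ} (P : Problem n l) (κ : Constants l) (a : Params) (ε : ℝ)
    (x₀ : Vec n) (start : ℕ → ℕ → Vec n) (bound : ℝ) : Prop :=
  ∃ K, 0 < K ∧ (∃ x y N, IsRun P κ a ε x₀ start K x y N) ∧
    ∀ x y N, IsRun P κ a ε x₀ start K x y N →
      ((∑ k ∈ Finset.range K, N k : ℕ) : ℝ) ≤ bound ∧ P.IsKKT ε (x K)

/-- Total complexity `Õ(ε^{-r})`. The constants `C, p` may depend on the problem, on the parameters
of the method, on `v`, and on the upper bound `F` for `f₀(x⁰)`, but not on `ε`, on `x⁰`,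
or on the starting points of the APG calls. -/
def HasComplexity {n l : ℕ} (P : Problem n l) (κ : Constants l) (a : Params) (v r : ℝ) : Prop :=
  ∀ F : ℝ, ∃ (C : ℝ) (p : ℕ), ∀ ε : ℝ, 0 < ε →
    ∀ x₀ ∈ P.dom, P.g x₀ + P.h x₀ ≤ F →
    ∀ start : ℕ → ℕ → Vec n, (∀ k j, start k j ∈ P.dom) →
    RegularAlong P κ a ε x₀ start v →
    ProducesKKTWithin P κ a ε x₀ start (C * (1 + ε ^ (-r)) * (1 + |Real.log ε|) ^ p)

end IALM

end

noncomputable section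

namespace IALM

/-! ### Two-sided quadratic bounds for smooth and weakly convex functions. -/

section QuadraticModels

variable {n : ℕ}

/-! Feasibility comes from a race between a geometric and a polynomial sequence. The dual step adds
a vector of norm at most `M (k+1)^q`, so `‖y^k‖ ≤ M k^(q+1)`. The output of iPPM is an
`ε`-stationary point of the augmented Lagrangian, so `∂h(x^{k+1})/β_k` has a point within `(ε + ‖∇g‖
+ ‖J_cᵀ y^k‖)/β_k` of `-J_cᵀ c`. Regularity then gives `v β_k ‖c(x^{k+1})‖ ≤ ε + Bg + BJ ‖y^k‖`
(`IsRun.norm_c_le`). Since `β_k` is geometric, `O(1 + |log ε|)` outer iterations suffice, and the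
last penalty is `Õ(1 + 1/ε)` (`exists_outer_count`). The KKT multiplier is `y^k + β_k c(x^{k+1})`.

The cost of one outer iteration is a number of proximal steps times the cost of each. A proximal
step that does not stop iPPM lowers the objective by at least `ε²/(32 ρ̂)` (`IsIPPMSeq.descent`), so
the number of steps is governed by `ρ̂ ε⁻²` times the initial gap. That gap grows only polynomially
in `k`, up to a factor `1 + ε`, although `β_k` explodes: in `β_k ‖c(x^k)‖²` one factor `‖c(x^k)‖`
cancels `β_{k-1}` by regularity (`IsRun.penalty_le`, `IsRun.gap_le`). Each proximal subproblem is
`ρ̂`-strongly convex and `(L̂ + 2ρ̂)`-smooth where APG evaluates it, so APG needs about `√((L̂ +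
2ρ̂)/ρ̂)` iterations up to a logarithm (`APGOutputs.le`).

With `L = L̂ + 2ρ̂`, the product has order `√(ρ̂ L) ε⁻²`. Always `L = Õ(1/ε)`. For general
constraints `ρ̂ = Õ(1/ε)`, giving `ε⁻³`; for affine ones `ρ_c = 0`, so `ρ̂` is polylogarithmic,
giving `ε^(-5/2)`. -/

lemma hasDerivAt_along {f : Vec n → ℝ} {f' w d : Vec n} {s : ℝ}
    (hf : HasGradientAt f f' (w + s • d)) :
    HasDerivAt (fun s : ℝ => f (w + s • d)) (inner ℝ f' d) s := by
  have h1 : HasDerivAt (fun s : ℝ => w + s • d) d s := by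
    simpa using ((hasDerivAt_id s).smul_const d).const_add w
  exact (hasGradientAt_iff_hasFDerivAt.mp hf).comp_hasDerivAt s h1

/-- The directional derivative is a limit of slopes bounded by `b`. This turns convexity
inequalities into first-order ones, for tangent bounds and for optimality conditions alike. -/
lemma inner_le_of_forall_line_le {f : Vec n → ℝ} {f' w d : Vec n} {b : ℝ}
    (hf : HasGradientAt f f' w) (h : ∀ s : ℝ, 0 < s → s ≤ 1 → f (w + s • d) - f w ≤ s * b) :
    inner ℝ f' d ≤ b := by
  have h1 : HasDerivAt (fun s : ℝ => f (w + s • d)) (inner ℝ f' d) 0 :=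
    hasDerivAt_along (by simpa using hf)
  have h2 := (hasDerivWithinAt_iff_tendsto_slope' (s := Set.Ioi (0 : ℝ)) (by simp)).mp
    h1.hasDerivWithinAt
  refine le_of_tendsto h2 ?_
  have h3 : Set.Ioc (0 : ℝ) 1 ∈ nhdsWithin (0 : ℝ) (Set.Ioi 0) := Ioc_mem_nhdsGT one_pos
  filter_upwards [h3] with s hs
  rw [slope_def_field]
  have := h s hs.1 hs.2
  simp only [zero_smul, add_zero, sub_zero]
  rw [div_le_iff₀ hs.1]
  linarith

/-- The descent lemma on a convex set. -/
lemma le_of_lipschitz_gradient {U : Set (Vec n)} {G : Vec n → ℝ} {G' : Vec n → Vec n} {L : ℝ}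
    (hgrad : ∀ x, HasGradientAt G (G' x) x) (hU : Convex ℝ U)
    (hlip : ∀ w ∈ U, ∀ z ∈ U, ‖G' z - G' w‖ ≤ L * ‖z - w‖) {w z : Vec n} (hw : w ∈ U)
    (hz : z ∈ U) : G z ≤ G w + inner ℝ (G' w) (z - w) + L / 2 * ‖z - w‖ ^ 2 := by
  set d := z - w with hd
  -- Gap between `G` and its quadratic upper model along the segment, up to a constant; it is
  -- nonincreasing, and the claim compares `s = 0` with `s = 1`.
  let ψ : ℝ → ℝ := fun s => G (w + s • d) - s * inner ℝ (G' w) d - L / 2 * ‖d‖ ^ 2 * s ^ 2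
  have hψ : ∀ s, HasDerivAt ψ
      (inner ℝ (G' (w + s • d)) d - inner ℝ (G' w) d - L / 2 * ‖d‖ ^ 2 * (2 * s)) s := by
    intro s
    have h1 := hasDerivAt_along (d := d) (hgrad (w + s • d))
    have h2 : HasDerivAt (fun s : ℝ => s * inner ℝ (G' w) d) (inner ℝ (G' w) d) s := by
      simpa using (hasDerivAt_id s).mul_const (inner ℝ (G' w) d)
    have h3 : HasDerivAt (fun s : ℝ => L / 2 * ‖d‖ ^ 2 * s ^ 2) (L / 2 * ‖d‖ ^ 2 * (2 * s)) s := by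
      simpa using ((hasDerivAt_pow 2 s).const_mul (L / 2 * ‖d‖ ^ 2))
    exact (h1.sub h2).sub h3
  have hanti : AntitoneOn ψ (Set.Icc 0 1) := by
    refine antitoneOn_of_deriv_nonpos (convex_Icc 0 1)
      (fun s _ => (hψ s).continuousAt.continuousWithinAt)
      (fun s _ => (hψ s).differentiableAt.differentiableWithinAt) fun s hs => ?_
    rw [interior_Icc] at hs
    rw [(hψ s).deriv, ← inner_sub_left]
    have hmem : w + s • d ∈ U := hU.add_smul_sub_mem hw hz ⟨hs.1.le, hs.2.le⟩
    have h1 := hlip w hw _ hmem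
    rw [add_sub_cancel_left, norm_smul, Real.norm_of_nonneg hs.1.le] at h1
    have h2 := real_inner_le_norm (G' (w + s • d) - G' w) d
    have h3 := mul_le_mul_of_nonneg_right h1 (norm_nonneg d)
    nlinarith
  have := hanti (Set.left_mem_Icc.mpr zero_le_one) (Set.right_mem_Icc.mpr zero_le_one) zero_le_one
  simp only [ψ, one_smul, zero_smul, hd] at this
  rw [add_sub_cancel] at this
  simp at this
  linarith

/-- On `U`, the function `G` with gradient `G'` lies above its linearisations up to a quadratic
term with coefficient `m / 2`, and its gradient is `L`-Lipschitz. -/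
structure QuadModel (U : Set (Vec n)) (G : Vec n → ℝ) (G' : Vec n → Vec n) (m L : ℝ) : Prop where
  grad : ∀ x, HasGradientAt G (G' x) x
  lower : ∀ w ∈ U, ∀ z ∈ U, G w + inner ℝ (G' w) (z - w) + m / 2 * ‖z - w‖ ^ 2 ≤ G z
  lip : ∀ w ∈ U, ∀ z ∈ U, ‖G' z - G' w‖ ≤ L * ‖z - w‖

namespace QuadModel

variable {U : Set (Vec n)} {G H : Vec n → ℝ} {G' H' : Vec n → Vec n} {m L m₂ L₂ : ℝ}

lemma upper (hG : QuadModel U G G' m L) (hU : Convex ℝ U) {w z : Vec n} (hw : w ∈ U)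
    (hz : z ∈ U) : G z ≤ G w + inner ℝ (G' w) (z - w) + L / 2 * ‖z - w‖ ^ 2 :=
  le_of_lipschitz_gradient hG.grad hU hG.lip hw hz

lemma add (hG : QuadModel U G G' m L) (hH : QuadModel U H H' m₂ L₂) :
    QuadModel U (fun x => G x + H x) (fun x => G' x + H' x) (m + m₂) (L + L₂) where
  grad x := by
    have h := (hasGradientAt_iff_hasFDerivAt.mp (hG.grad x)).add
      (hasGradientAt_iff_hasFDerivAt.mp (hH.grad x))
    rw [hasGradientAt_iff_hasFDerivAt, map_add]
    exact h
  lower w hw z hz := by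
    have h1 := hG.lower w hw z hz
    have h2 := hH.lower w hw z hz
    rw [inner_add_left]
    linarith
  lip w hw z hz := by
    have h1 := hG.lip w hw z hz
    have h2 := hH.lip w hw z hz
    have h3 := norm_add_le (G' z - G' w) (H' z - H' w)
    rw [add_sub_add_comm]
    linarith

lemma const_mul (hG : QuadModel U G G' m L) {r : ℝ} (hr : 0 ≤ r) :
    QuadModel U (fun x => r * G x) (fun x => r • G' x) (r * m) (r * L) where
  grad x := by
    have h := (hasGradientAt_iff_hasFDerivAt.mp (hG.grad x)).const_mul r
    rw [hasGradientAt_iff_hasFDerivAt, map_smulₛₗ]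
    exact h
  lower w hw z hz := by
    have h1 := mul_le_mul_of_nonneg_left (hG.lower w hw z hz) hr
    rw [real_inner_smul_left]
    linarith
  lip w hw z hz := by
    have h1 := mul_le_mul_of_nonneg_left (hG.lip w hw z hz) hr
    rw [← smul_sub, norm_smul, Real.norm_of_nonneg hr]
    linarith

lemma zero (U : Set (Vec n)) : QuadModel U (fun _ => 0) (fun _ => 0) 0 0 where
  grad x := hasGradientAt_const x 0
  lower w _ z _ := by simp
  lip w _ z _ := by simp

lemma sum {ι : Type*} (s : Finset ι) {G : ι → Vec n → ℝ} {G' : ι → Vec n → Vec n} {m L : ι → ℝ}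
    (h : ∀ i ∈ s, QuadModel U (G i) (G' i) (m i) (L i)) :
    QuadModel U (fun x => ∑ i ∈ s, G i x) (fun x => ∑ i ∈ s, G' i x) (∑ i ∈ s, m i)
      (∑ i ∈ s, L i) := by
  classical
  induction s using Finset.induction_on with
  | empty => simpa using zero U
  | insert a s ha ih =>
    simp only [Finset.sum_insert ha]
    exact (h a (Finset.mem_insert_self a s)).add
      (ih fun i hi => h i (Finset.mem_insert_of_mem hi))

lemma mono (hG : QuadModel U G G' m L) (hm : m₂ ≤ m) (hL : L ≤ L₂) : QuadModel U G G' m₂ L₂ where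
  grad := hG.grad
  lower w hw z hz := by
    have h1 := hG.lower w hw z hz
    have h2 := mul_le_mul_of_nonneg_right hm (sq_nonneg ‖z - w‖)
    linarith
  lip w hw z hz := (hG.lip w hw z hz).trans (mul_le_mul_of_nonneg_right hL (norm_nonneg _))

/-- Adding the proximal term `ρ‖· - x₀‖²`. -/
lemma add_prox (hG : QuadModel U G G' m L) {ρ : ℝ} (hρ : 0 ≤ ρ) (x₀ : Vec n) :
    QuadModel U (fun x => G x + ρ * ‖x - x₀‖ ^ 2) (fun x => G' x + (2 * ρ) • (x - x₀))
      (m + 2 * ρ) (L + 2 * ρ) := by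
  refine hG.add ⟨fun x => ?_, fun w _ z _ => le_of_eq ?_, fun w _ z _ => le_of_eq ?_⟩
  · have h1 : HasFDerivAt (fun x : Vec n => x - x₀) (ContinuousLinearMap.id ℝ (Vec n)) x :=
      (hasFDerivAt_id x).sub_const x₀
    have h2 := (h1.norm_sq).const_mul ρ
    rw [hasGradientAt_iff_hasFDerivAt]
    refine h2.congr_fderiv ?_
    ext v
    simp
    ring
  · have : z - x₀ = (w - x₀) + (z - w) := by abel
    rw [this, norm_add_sq_real, real_inner_smul_left]
    ring
  · rw [← smul_sub, norm_smul, Real.norm_of_nonneg (by positivity)]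
    congr 2
    abel

end QuadModel

/-- Tangent inequality for the convex function `f + ρ/2 ‖·‖²`, with the square expanded around `w`.
-/
lemma IsWeaklyConvex.lower {f : Vec n → ℝ} {f' : Vec n} {ρ : ℝ} (hf : IsWeaklyConvex ρ f)
    {w : Vec n} (hg : HasGradientAt f f' w) (z : Vec n) :
    f w + inner ℝ f' (z - w) - ρ / 2 * ‖z - w‖ ^ 2 ≤ f z := by
  have h1 : HasGradientAt (fun x => f x + ρ / 2 * ‖x‖ ^ 2) (f' + ρ • w) w := by
    have h2 := ((hasFDerivAt_id w).norm_sq).const_mul (ρ / 2)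
    have h3 := (hasGradientAt_iff_hasFDerivAt.mp hg).add h2
    rw [hasGradientAt_iff_hasFDerivAt]
    refine h3.congr_fderiv ?_
    ext v
    simp
    ring
  have h2 := inner_le_of_forall_line_le (d := z - w)
    (b := (f z + ρ / 2 * ‖z‖ ^ 2) - (f w + ρ / 2 * ‖w‖ ^ 2)) h1 fun s hs hs1 => by
      have h := hf.2 (Set.mem_univ w) (Set.mem_univ z) (sub_nonneg.mpr hs1) hs.le (by ring)
      have e : (1 - s) • w + s • z = w + s • (z - w) := by
        rw [sub_smul, one_smul, smul_sub]; abel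
      rw [e] at h
      simp only [smul_eq_mul] at h
      linarith
  have h3 : ‖z‖ ^ 2 = ‖w‖ ^ 2 + 2 * inner ℝ w (z - w) + ‖z - w‖ ^ 2 := by
    rw [← norm_add_sq_real, add_sub_cancel]
  rw [inner_add_left, real_inner_smul_left, h3] at h2
  linarith

lemma IsLSmooth.hasGradientAt {f : Vec n → ℝ} {L : ℝ} (hf : IsLSmooth L f) (x : Vec n) :
    HasGradientAt f (gradient f x) x := (hf.1 x).hasGradientAt

lemma IsLSmooth.quadModel {f : Vec n → ℝ} {L ρ : ℝ} (hf : IsLSmooth L f)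
    (hw : IsWeaklyConvex ρ f) (U : Set (Vec n)) : QuadModel U f (gradient f) (-ρ) L where
  grad := hf.hasGradientAt
  lower w _ z _ := by
    have := hw.lower (hf.hasGradientAt w) z
    linarith
  lip w _ z _ := hf.2 z w

lemma HasGradientAt.const_mul {f : Vec n → ℝ} {f' x : Vec n} (hf : HasGradientAt f f' x) (r : ℝ) :
    HasGradientAt (fun x => r * f x) (r • f') x := by
  have h := (hasGradientAt_iff_hasFDerivAt.mp hf).const_mul r
  rw [hasGradientAt_iff_hasFDerivAt, map_smulₛₗ]
  exact h

/-- A multiplier `r` may have either sign, so weak convexity of `f` is of no use here; the descent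
lemma for `-r f` supplies the lower bound. This is why `L̄‖y‖` enters `ρ̂`. -/
lemma IsLSmooth.quadModel_const_mul {f : Vec n → ℝ} {L : ℝ} (hf : IsLSmooth L f)
    (U : Set (Vec n)) (r : ℝ) :
    QuadModel U (fun x => r * f x) (fun x => r • gradient f x) (-(|r| * L)) (|r| * L) where
  grad x := HasGradientAt.const_mul (hf.hasGradientAt x) r
  lower w _ z _ := by
    have h := le_of_lipschitz_gradient (U := Set.univ) (G := fun x => -r * f x)
      (G' := fun x => -r • gradient f x) (L := |r| * L)
      (fun x => HasGradientAt.const_mul (hf.hasGradientAt x) (-r)) convex_univ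
      (fun w _ z _ => by
        rw [← smul_sub, norm_smul, Real.norm_eq_abs, abs_neg, mul_assoc]
        exact mul_le_mul_of_nonneg_left (hf.2 z w) (abs_nonneg r))
      (Set.mem_univ w) (Set.mem_univ z)
    simp only [neg_smul, inner_neg_left] at h
    linarith
  lip w _ z _ := by
    rw [← smul_sub, norm_smul, Real.norm_eq_abs, mul_assoc]
    exact mul_le_mul_of_nonneg_left (hf.2 z w) (abs_nonneg r)

lemma HasGradientAt.half_sq {f : Vec n → ℝ} {f' x : Vec n} (hf : HasGradientAt f f' x) :
    HasGradientAt (fun x => f x ^ 2 / 2) (f x • f') x := by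
  have h := ((hasGradientAt_iff_hasFDerivAt.mp hf).pow 2).mul_const (1 / 2 : ℝ)
  rw [hasGradientAt_iff_hasFDerivAt, map_smulₛₗ]
  refine (h.congr_fderiv ?_).congr_of_eventuallyEq (Filter.Eventually.of_forall fun z => ?_)
  · ext v
    simp
    ring
  · simp only
    ring

lemma abs_sub_le_of_norm_gradient_le {f : Vec n → ℝ} {f' : Vec n → Vec n} {U : Set (Vec n)}
    {B : ℝ} (hf : ∀ x, HasGradientAt f (f' x) x) (hU : Convex ℝ U) (hB : ∀ x ∈ U, ‖f' x‖ ≤ B)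
    {w z : Vec n} (hw : w ∈ U) (hz : z ∈ U) : |f z - f w| ≤ B * ‖z - w‖ := by
  rw [← Real.norm_eq_abs]
  refine hU.norm_image_sub_le_of_norm_hasFDerivWithin_le (𝕜 := ℝ)
    (fun x _ => (hasGradientAt_iff_hasFDerivAt.mp (hf x)).hasFDerivWithinAt) (fun x hx => ?_) hw hz
  rw [LinearIsometryEquiv.norm_map]
  exact hB x hx

/-- Convexity of the square gives `f(z)²/2 ≥ f(w)²/2 + f(w)(f(z) - f(w))`. Since `f(w)` may be
negative, the linearisation error of `f` has to be bounded on both sides, hence weak convexity of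
`f` and of `-f`. -/
lemma quadModel_half_sq {f : Vec n → ℝ} {U : Set (Vec n)} {B L ρ : ℝ} (hf : IsLSmooth L f)
    (h1 : IsWeaklyConvex ρ f) (h2 : IsWeaklyConvex ρ fun x => -f x)
    (hU : Convex ℝ U) (hB : ∀ x ∈ U, |f x| ≤ B ∧ ‖gradient f x‖ ≤ B) :
    QuadModel U (fun x => f x ^ 2 / 2) (fun x => f x • gradient f x) (-(B * ρ))
      (B * L + B ^ 2) where
  grad x := HasGradientAt.half_sq (hf.hasGradientAt x)
  lower w hw z hz := by
    have e1 := h1.lower (hf.hasGradientAt w) z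
    have e2 := h2.lower (f' := -gradient f w) (w := w)
      (by simpa using HasGradientAt.const_mul (hf.hasGradientAt w) (-1)) z
    simp only [inner_neg_left] at e2
    rw [real_inner_smul_left]
    have hb := (hB w hw).1
    set a := f z - f w - inner ℝ (gradient f w) (z - w) with ha
    have h3 : |a| ≤ ρ / 2 * ‖z - w‖ ^ 2 := abs_le.mpr ⟨by linarith, by linarith⟩
    have h4 : |f w * a| ≤ B * (ρ / 2 * ‖z - w‖ ^ 2) := by
      rw [abs_mul]
      exact mul_le_mul hb h3 (abs_nonneg _) ((abs_nonneg _).trans hb)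
    have h5 := (abs_le.mp h4).1
    have h6 : f w * a = f w * f z - f w ^ 2 - f w * inner ℝ (gradient f w) (z - w) := by
      rw [ha]; ring
    nlinarith [sq_nonneg (f z - f w)]
  lip w hw z hz := by
    have e : f z • gradient f z - f w • gradient f w =
        f z • (gradient f z - gradient f w) + (f z - f w) • gradient f w := by
      rw [smul_sub, sub_smul]; abel
    rw [e]
    have hb := (hB z hz).1
    refine (norm_add_le _ _).trans ?_
    rw [norm_smul, norm_smul, Real.norm_eq_abs, Real.norm_eq_abs, add_mul]
    refine add_le_add ?_ ?_
    · rw [mul_assoc]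
      exact mul_le_mul hb (hf.2 z w) (norm_nonneg _) ((abs_nonneg _).trans hb)
    · have h3 := abs_sub_le_of_norm_gradient_le hf.hasGradientAt hU (fun x hx => (hB x hx).2) hw hz
      have h4 := mul_le_mul h3 (hB w hw).2 (norm_nonneg _) ((abs_nonneg _).trans h3)
      linarith

/-- The square of an affine function is a convex quadratic on the whole space, so a bound on its
constant gradient controls extrapolated points anywhere. -/
lemma quadModel_half_sq_of_affine {f : Vec n → ℝ} {a : Vec n} {b B L : ℝ}
    (hf : ∀ x, f x = inner ℝ a x + b) (hL : 0 ≤ L) (hB₀ : 0 ≤ B) (hB : ‖a‖ ≤ B) :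
    QuadModel Set.univ (fun x => f x ^ 2 / 2) (fun x => f x • a) 0 (B * L + B ^ 2) where
  grad x := by
    refine HasGradientAt.half_sq (hasGradientAt_iff_hasFDerivAt.mpr ?_)
    rw [funext hf]
    exact ((InnerProductSpace.toDual ℝ (Vec n) a).hasFDerivAt).add_const b
  lower w _ z _ := by
    rw [real_inner_smul_left, inner_sub_right]
    have e : inner ℝ a z - inner ℝ a w = f z - f w := by rw [hf, hf]; ring
    rw [e]
    nlinarith [sq_nonneg (f z - f w)]
  lip w _ z _ := by
    rw [← sub_smul, norm_smul, Real.norm_eq_abs]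
    have e : f z - f w = inner ℝ a (z - w) := by rw [hf, hf, inner_sub_right]; ring
    rw [e]
    have h1 := abs_real_inner_le_norm a (z - w)
    have h2 := norm_nonneg (z - w)
    calc |inner ℝ a (z - w)| * ‖a‖ ≤ (‖a‖ * ‖z - w‖) * ‖a‖ := by gcongr
      _ ≤ (B * ‖z - w‖) * B := by gcongr
      _ ≤ (B * L + B ^ 2) * ‖z - w‖ := by nlinarith [mul_nonneg (mul_nonneg hB₀ hL) h2]

end QuadraticModels

/-! ### The smooth part of the augmented Lagrangian on sets containing all extrapolated points. -/

namespace Problem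

variable {n l : ℕ} {P : Problem n l} {κ : Constants l}

lemma Standing.differentiable_c (hP : P.Standing κ) : Differentiable ℝ P.c :=
  differentiable_euclidean.mpr fun i => (hP.c_smooth i).1

lemma Standing.jacT_eq (hP : P.Standing κ) (x : Vec n) (y : Vec l) :
    P.jacT x y = ∑ i, y i • gradient (fun z => P.c z i) x := by
  refine ext_inner_right ℝ fun d => ?_
  rw [jacT, ContinuousLinearMap.adjoint_inner_left, sum_inner, PiLp.inner_apply]
  refine Finset.sum_congr rfl fun i _ => ?_
  rw [real_inner_smul_left, inner_gradient_left]
  have h := ((EuclideanSpace.proj (𝕜 := ℝ) i).hasFDerivAt.comp x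
    (hP.differentiable_c x).hasFDerivAt).fderiv
  have h' : fderiv ℝ (fun z => P.c z i) x = (EuclideanSpace.proj i).comp (fderiv ℝ P.c x) := h
  rw [h']
  simp [mul_comm]

/-- The gradient of the smooth part of the augmented Lagrangian. -/
def gradAL (P : Problem n l) (β : ℝ) (y : Vec l) (x : Vec n) : Vec n :=
  gradient P.g x + P.jacT x y + β • P.jacT x (P.c x)

/-- Regularity of the penalised problem on `U`: all squares of the constraints have quadratic
models on the convex set `U`, which contains all extrapolated points. -/
structure Admissible (P : Problem n l) (κ : Constants l) (U : Set (Vec n)) : Prop where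
  convex : Convex ℝ U
  mem : ∀ u ∈ P.dom, ∀ u' ∈ P.dom, ∀ θ : ℝ, 0 ≤ θ → θ ≤ 1 → u + θ • (u - u') ∈ U
  sq : ∀ i, QuadModel U (fun x => P.c x i ^ 2 / 2)
    (fun x => P.c x i • gradient (fun z => P.c z i) x) (-(κ.B i * κ.ρ i))
    (κ.B i * κ.L i + κ.B i ^ 2)
  bounds : P.BoundsOn κ P.dom

lemma Admissible.dom_subset {U : Set (Vec n)} (hU : Admissible P κ U) : P.dom ⊆ U := fun u hu => by
  simpa using hU.mem u hu u hu 0 le_rfl zero_le_one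

lemma Admissible.quadModel {U : Set (Vec n)} (hU : Admissible P κ U) (hP : P.Standing κ) {β : ℝ}
    (hβ : 0 ≤ β) (y : Vec l) :
    QuadModel U (P.smoothAL β y) (P.gradAL β y) (-κ.ρhat β y) (κ.Lhat β y) := by
  have h := ((hP.g_smooth.quadModel hP.g_weak U).add (QuadModel.sum Finset.univ
    fun i _ => (hP.c_smooth i).quadModel_const_mul U (y i))).add
    ((QuadModel.sum Finset.univ fun i _ => hU.sq i).const_mul hβ)
  -- Cauchy–Schwarz turns the separate moduli `|y_i| L_i` into `L̄‖y‖`.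
  have hcs : ∑ i, |y i| * κ.L i ≤ κ.Lbar * ‖y‖ := by
    refine (Real.sum_mul_le_sqrt_mul_sqrt _ _ _).trans (le_of_eq ?_)
    rw [Constants.Lbar, EuclideanSpace.norm_eq, mul_comm]
    simp
  have e1 : P.smoothAL β y = fun x => P.g x + ∑ i, y i * P.c x i + β * ∑ i, P.c x i ^ 2 / 2 := by
    funext x
    rw [smoothAL, EuclideanSpace.norm_sq_eq, PiLp.inner_apply, ← Finset.sum_div]
    simp only [Real.norm_eq_abs, sq_abs]
    have : ∀ i, inner ℝ (y i) (P.c x i) = y i * P.c x i := fun i => by simp [mul_comm]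
    simp only [this]
    ring
  have e2 : P.gradAL β y = fun x => gradient P.g x + ∑ i, y i • gradient (fun z => P.c z i) x +
      β • ∑ i, P.c x i • gradient (fun z => P.c z i) x := by
    funext x
    rw [gradAL, hP.jacT_eq, hP.jacT_eq]
  rw [e1, e2]
  refine h.mono ?_ ?_
  · rw [Constants.ρhat, Constants.ρc, Finset.sum_neg_distrib, Finset.sum_neg_distrib]
    linarith
  · rw [Constants.Lhat, Constants.Lc]
    linarith

lemma Standing.convex_dom (hP : P.Standing κ) : Convex ℝ P.dom := hP.h_convex.1

lemma Standing.admissible_extrapolated (hP : P.Standing κ)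
    (hw : ∀ i, IsWeaklyConvex (κ.ρ i) (fun x => -(P.c x i))) (hB : P.BoundsOn κ P.extrapolated) :
    Admissible P κ P.extrapolated := by
  have hconv : Convex ℝ P.extrapolated := by
    rintro _ ⟨u, hu, u', hu', rfl⟩ _ ⟨z, hz, z', hz', rfl⟩ r s hr hs hrs
    refine ⟨_, hP.convex_dom hu hz hr hs hrs, _, hP.convex_dom hu' hz' hr hs hrs, ?_⟩
    simp only [smul_add, smul_sub]
    abel
  refine ⟨hconv, ?_, fun i => ?_, ?_⟩
  · intro u hu u' hu' θ h0 h1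
    -- A short extrapolation `u + θ(u - u')` is a full one away from the point `u + θ(u' - u)` of
    -- the convex domain.
    refine ⟨u, hu, u + θ • (u' - u), hP.convex_dom.add_smul_sub_mem hu hu' ⟨h0, h1⟩, ?_⟩
    simp only [smul_sub]
    abel
  · exact quadModel_half_sq (hP.c_smooth i) (hP.c_weak i) (hw i)
      hconv (hB i)
  · intro i x hx
    exact hB i x ⟨x, hx, x, hx, by simp⟩

lemma Standing.admissible_univ (hP : P.Standing κ)
    (hA : ∃ (A : Vec n →L[ℝ] Vec l) (b : Vec l), ∀ x, P.c x = A x - b)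
    (hρ : ∀ i, κ.ρ i = 0) (hB : P.BoundsOn κ P.dom) : Admissible P κ Set.univ := by
  obtain ⟨A, b, hAb⟩ := hA
  obtain ⟨x₀, hx₀⟩ := hP.dom_nonempty
  refine ⟨convex_univ, fun _ _ _ _ _ _ _ => Set.mem_univ _, fun i => ?_, hB⟩
  let a : Vec n := (InnerProductSpace.toDual ℝ (Vec n)).symm ((EuclideanSpace.proj i).comp A)
  have hf : ∀ x, P.c x i = inner ℝ a x + -b i := fun x => by
    simp [a, hAb, sub_eq_add_neg]
  have hg : ∀ x, gradient (fun z => P.c z i) x = a := fun x => by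
    refine HasGradientAt.gradient (hasGradientAt_iff_hasFDerivAt.mpr ?_)
    rw [funext hf]
    exact ((InnerProductSpace.toDual ℝ (Vec n) a).hasFDerivAt).add_const _
  have h := hB i x₀ hx₀
  rw [hg] at h
  have hm := quadModel_half_sq_of_affine hf (hP.L_nonneg i) ((abs_nonneg _).trans h.1) h.2
  simp only [hg, hρ]
  simpa using hm

end Problem
end IALM

/-! ### The accelerated proximal gradient method: linear convergence and termination. -/

namespace IALM
namespace Problem

variable {n l : ℕ} {P : Problem n l} {κ : Constants l}

lemma Standing.exists_min (hP : P.Standing κ) {s : Vec n → ℝ} (hs : Continuous s) :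
    ∃ x ∈ P.dom, ∀ z ∈ P.dom, s x + P.h x ≤ s z + P.h z := by
  obtain ⟨x, hx, hmin⟩ := LowerSemicontinuousOn.exists_isMinOn hP.dom_nonempty hP.dom_compact
    (hs.continuousOn.lowerSemicontinuousOn.add hP.h_lsc)
  exact ⟨x, hx, fun z hz => hmin hz⟩

lemma Standing.neg_mem_subdiffH (hP : P.Standing κ) {s : Vec n → ℝ} {s' x : Vec n}
    (hs : HasGradientAt s s' x) (hx : x ∈ P.dom)
    (hmin : ∀ z ∈ P.dom, s x + P.h x ≤ s z + P.h z) : -s' ∈ P.subdiffH x := by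
  refine ⟨hx, fun z hz => ?_⟩
  have h := inner_le_of_forall_line_le (d := z - x) (b := P.h z - P.h x)
    (HasGradientAt.const_mul hs (-1)) fun r hr hr1 => by
      have h1 := hP.h_convex.2 hx hz (sub_nonneg.mpr hr1) hr.le (by ring)
      have e : (1 - r) • x + r • z = x + r • (z - x) := by
        rw [sub_smul, one_smul, smul_sub]; abel
      rw [e] at h1
      have h2 := hmin _ (hP.convex_dom.add_smul_sub_mem hx hz ⟨hr.le, hr1⟩)
      simp only [smul_eq_mul] at h1
      linarith
  simp only [neg_smul, one_smul] at h
  linarith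

lemma hasGradientAt_proxModel (p w x : Vec n) (L : ℝ) :
    HasGradientAt (fun x => inner ℝ p x + L / 2 * ‖x - w‖ ^ 2) (p + L • (x - w)) x := by
  have h1 : HasFDerivAt (fun x : Vec n => x - w) (ContinuousLinearMap.id ℝ (Vec n)) x :=
    (hasFDerivAt_id x).sub_const w
  have h2 := ((InnerProductSpace.toDual ℝ (Vec n) p).hasFDerivAt (x := x)).add
    ((h1.norm_sq).const_mul (L / 2))
  rw [hasGradientAt_iff_hasFDerivAt]
  refine h2.congr_fderiv ?_
  ext v
  simp
  ring

lemma Standing.exists_proxGradStep (hP : P.Standing κ) (G : Vec n → ℝ) (L : ℝ) (w : Vec n) :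
    ∃ x, P.IsProxGradStep G L w x := by
  obtain ⟨x, hx, h⟩ := hP.exists_min
    (s := fun x => inner ℝ (gradient G w) x + L / 2 * ‖x - w‖ ^ 2) (by fun_prop)
  exact ⟨x, hx, h⟩

lemma IsProxGradStep.neg_mem_subdiffH {G : Vec n → ℝ} {L : ℝ} {w x : Vec n}
    (h : P.IsProxGradStep G L w x) (hP : P.Standing κ) :
    -(gradient G w + L • (x - w)) ∈ P.subdiffH x :=
  hP.neg_mem_subdiffH (hasGradientAt_proxModel _ w x L) h.1 h.2

/-- Adds the subgradient inequality of `h` at `x`, the upper model from `w` at `x` and the lower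
model from `w` at `z`; expanding `‖z - w‖²` around `x` cancels the inner products. -/
lemma IsProxGradStep.descent {G : Vec n → ℝ} {G' : Vec n → Vec n} {U : Set (Vec n)} {μ L : ℝ}
    {w x z : Vec n} (h : P.IsProxGradStep G L w x) (hP : P.Standing κ) (hU : Admissible P κ U)
    (hG : QuadModel U G G' μ L) (hw : w ∈ U) (hz : z ∈ P.dom) :
    G x + P.h x + L / 2 * ‖z - x‖ ^ 2 ≤ G z + P.h z + (L - μ) / 2 * ‖z - w‖ ^ 2 := by
  have h1 := (h.neg_mem_subdiffH hP).2 z hz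
  rw [(hG.grad w).gradient] at h1
  have h2 := hG.upper hU.convex hw (hU.dom_subset h.1)
  have h3 := hG.lower w hw z (hU.dom_subset hz)
  have e1 : z - w = (z - x) + (x - w) := by abel
  have e2 : ‖z - w‖ ^ 2 = ‖z - x‖ ^ 2 + 2 * inner ℝ (x - w) (z - x) + ‖x - w‖ ^ 2 := by
    rw [e1, norm_add_sq_real, real_inner_comm]
  have e3 : inner ℝ (G' w) (z - w) = inner ℝ (G' w) (z - x) + inner ℝ (G' w) (x - w) := by
    rw [← inner_add_right, ← e1]
  rw [inner_neg_left, inner_add_left, real_inner_smul_left] at h1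
  have e4 : L / 2 * ‖z - w‖ ^ 2 =
      L / 2 * ‖z - x‖ ^ 2 + L * inner ℝ (x - w) (z - x) + L / 2 * ‖x - w‖ ^ 2 := by
    rw [e2]; ring
  rw [e3] at h3
  linarith

/-- One step of the Lyapunov contraction, with `μ = L α²`: weight the descent inequality against the
previous iterate by `1 - α` and that against `xs` by `α`. The sum is the claim except for the
nonnegative surplus `h5`. -/
lemma accelerated_descent {L α Fx Fx' Fs : ℝ} (hL : 0 ≤ L) (hα : 0 ≤ α) (hα' : α ≤ 1)
    {x w x' xs : Vec n}
    (h1 : Fx' + L / 2 * ‖x - x'‖ ^ 2 ≤ Fx + (L - L * α ^ 2) / 2 * ‖x - w‖ ^ 2)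
    (h2 : Fx' + L / 2 * ‖xs - x'‖ ^ 2 ≤ Fs + (L - L * α ^ 2) / 2 * ‖xs - w‖ ^ 2) :
    Fx' - Fs + L / 2 * ‖x' - (1 - α) • x - α • xs‖ ^ 2 ≤
      (1 - α) * (Fx - Fs + L / 2 * ‖(1 + α) • w - x - α • xs‖ ^ 2) := by
  set a := x - w with ha
  set b := xs - w with hb
  set g := w - x' with hg
  have e1 : x - x' = a + g := by rw [ha, hg]; abel
  have e2 : xs - x' = b + g := by rw [hb, hg]; abel
  have e3 : x' - (1 - α) • x - α • xs = -(g + ((1 - α) • a + α • b)) := by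
    rw [ha, hb, hg]; module
  have e4 : (1 + α) • w - x - α • xs = -(a + α • b) := by
    rw [ha, hb]; module
  rw [e1, norm_add_sq_real] at h1
  rw [e2, norm_add_sq_real] at h2
  rw [e3, e4, norm_neg, norm_neg, norm_add_sq_real, norm_add_sq_real, norm_add_sq_real,
    inner_add_right, norm_smul, norm_smul, real_inner_smul_left, real_inner_smul_right,
    real_inner_smul_right, real_inner_smul_right, mul_pow, mul_pow,
    Real.norm_eq_abs, Real.norm_eq_abs, sq_abs, sq_abs, real_inner_comm a g, real_inner_comm b g]
  have h3 := mul_le_mul_of_nonneg_left h1 (sub_nonneg.mpr hα')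
  have h4 := mul_le_mul_of_nonneg_left h2 hα
  have h5 : 0 ≤ L / 2 * ((1 - α) * (α + α ^ 2)) * ‖a‖ ^ 2 := by
    have := sub_nonneg.mpr hα'
    positivity
  linarith

/-- `u` and `w` are the iterates of the first `T` iterations of APG. -/
structure IsAPGSeq (P : Problem n l) (G : Vec n → ℝ) (μ L : ℝ) (start : Vec n) (T : ℕ)
    (u w : ℕ → Vec n) : Prop where
  first : P.IsProxGradStep G L start (u 0)
  w_zero : w 0 = u 0
  step : ∀ t < T, P.IsProxGradStep G L (w t) (u (t + 1))
  extrapolate : ∀ t < T, w (t + 1) = u (t + 1) +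
    ((1 - Real.sqrt (μ / L)) / (1 + Real.sqrt (μ / L))) • (u (t + 1) - u t)

namespace IsAPGSeq

variable {G : Vec n → ℝ} {G' : Vec n → Vec n} {U : Set (Vec n)} {μ L δ D : ℝ}
  {start : Vec n} {T : ℕ} {u w : ℕ → Vec n}

lemma mem_dom (h : IsAPGSeq P G μ L start T u w) {t : ℕ} (ht : t ≤ T) : u t ∈ P.dom := by
  cases t with
  | zero => exact h.first.1
  | succ t => exact (h.step t ht).1

lemma exists_extrapolate (h : IsAPGSeq P G μ L start T u w) (hμ : 0 < μ) (hμL : μ ≤ L) {t : ℕ}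
    (ht : t ≤ T) : ∃ θ : ℝ, 0 ≤ θ ∧ θ ≤ 1 ∧ w t = u t + θ • (u t - u (t - 1)) := by
  have hL := hμ.trans_le hμL
  cases t with
  | zero => exact ⟨0, le_rfl, zero_le_one, by simp [h.w_zero]⟩
  | succ t =>
    have h1 : Real.sqrt (μ / L) ≤ 1 := Real.sqrt_le_one.mpr ((div_le_one hL).mpr hμL)
    have h0 := Real.sqrt_nonneg (μ / L)
    exact ⟨_, div_nonneg (by linarith) (by linarith),
      (div_le_one (by linarith)).mpr (by linarith), h.extrapolate t ht⟩

lemma w_mem (h : IsAPGSeq P G μ L start T u w) (hU : Admissible P κ U) (hμ : 0 < μ)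
    (hμL : μ ≤ L) {t : ℕ} (ht : t ≤ T) : w t ∈ U := by
  obtain ⟨θ, h0, h1, e⟩ := h.exists_extrapolate hμ hμL ht
  rw [e]
  exact hU.mem _ (h.mem_dom ht) _ (h.mem_dom (by omega)) θ h0 h1

/-- The momentum coefficient is chosen for this identity: the Lyapunov vector produced by one step
is the one consumed by the next. -/
lemma extrapolate_eq (h : IsAPGSeq P G μ L start T u w) {t : ℕ} (ht : t < T) :
    (1 + Real.sqrt (μ / L)) • w (t + 1) - u (t + 1) =
      u (t + 1) - (1 - Real.sqrt (μ / L)) • u t := by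
  have h0 := Real.sqrt_nonneg (μ / L)
  have h1 : (1 + Real.sqrt (μ / L)) ≠ 0 := by linarith
  rw [h.extrapolate t ht, smul_add, smul_smul, mul_div_cancel₀ _ h1]
  module

/-- Linear convergence of the Lyapunov function of APG. -/
lemma lyapunov (h : IsAPGSeq P G μ L start T u w) (hP : P.Standing κ) (hU : Admissible P κ U)
    (hG : QuadModel U G G' μ L) (hμ : 0 < μ) (hμL : μ ≤ L) {xs : Vec n} (hxs : xs ∈ P.dom)
    (t : ℕ) (ht : t ≤ T) :
    G (u t) + P.h (u t) - (G xs + P.h xs) +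
      L / 2 * ‖(1 + Real.sqrt (μ / L)) • w t - u t - Real.sqrt (μ / L) • xs‖ ^ 2 ≤
    (1 - Real.sqrt (μ / L)) ^ t * (G (u 0) + P.h (u 0) - (G xs + P.h xs) +
      L / 2 * ‖(1 + Real.sqrt (μ / L)) • w 0 - u 0 - Real.sqrt (μ / L) • xs‖ ^ 2) := by
  have hL := hμ.trans_le hμL
  have hα1 : Real.sqrt (μ / L) ≤ 1 := Real.sqrt_le_one.mpr ((div_le_one hL).mpr hμL)
  have hα0 := Real.sqrt_nonneg (μ / L)
  have hμe : L * Real.sqrt (μ / L) ^ 2 = μ := by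
    rw [Real.sq_sqrt (by positivity)]
    field_simp
  induction t with
  | zero => simp
  | succ t ih =>
    have hw := h.w_mem hU hμ hμL (t := t) (by omega)
    have d1 := (h.step t ht).descent hP hU hG hw (h.mem_dom (t := t) (by omega))
    have d2 := (h.step t ht).descent hP hU hG hw hxs
    rw [← hμe] at d1 d2
    have hd := accelerated_descent hL.le hα0 hα1 d1 d2
    rw [h.extrapolate_eq ht]
    refine hd.trans ?_
    rw [pow_succ' (1 - Real.sqrt (μ / L)), mul_assoc]
    exact mul_le_mul_of_nonneg_left (ih (by omega)) (by linarith)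

/-- Strong convexity bounds the distance to the minimiser by the Lyapunov function. The initial prox
step from `start` bounds that function at time `0` by `L/2 D²`, so no function values at the
starting point enter. -/
lemma dist_sq_le (h : IsAPGSeq P G μ L start T u w) (hP : P.Standing κ) (hU : Admissible P κ U)
    (hG : QuadModel U G G' μ L) (hμ : 0 < μ) (hμL : μ ≤ L) (hstart : start ∈ P.dom)
    (hD : ∀ z ∈ P.dom, ∀ z' ∈ P.dom, ‖z - z'‖ ≤ D) {xs : Vec n} (hxs : xs ∈ P.dom)
    (hmin : ∀ z ∈ P.dom, G xs + P.h xs ≤ G z + P.h z) {t : ℕ} (ht : t ≤ T) :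
    ‖u t - xs‖ ^ 2 ≤ (1 - Real.sqrt (μ / L)) ^ t * (L / μ * D ^ 2) := by
  have hL := hμ.trans_le hμL
  have hα1 : Real.sqrt (μ / L) ≤ 1 := Real.sqrt_le_one.mpr ((div_le_one hL).mpr hμL)
  have hμe : L * Real.sqrt (μ / L) ^ 2 = μ := by
    rw [Real.sq_sqrt (by positivity)]
    field_simp
  have h1 := h.lyapunov hP hU hG hμ hμL hxs t ht
  have h2 := h.first.descent hP hU hG (hU.dom_subset hstart) hxs
  have e0 : (1 + Real.sqrt (μ / L)) • w 0 - u 0 - Real.sqrt (μ / L) • xs =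
      Real.sqrt (μ / L) • (u 0 - xs) := by
    rw [h.w_zero]; module
  rw [e0, norm_smul, mul_pow, Real.norm_eq_abs, sq_abs] at h1
  have h3 : ‖xs - start‖ ^ 2 ≤ D ^ 2 := by
    have := hD _ hxs _ hstart
    gcongr
  have h4 : G (u 0) + P.h (u 0) - (G xs + P.h xs) +
      L / 2 * (Real.sqrt (μ / L) ^ 2 * ‖u 0 - xs‖ ^ 2) ≤ L / 2 * D ^ 2 := by
    have e : L / 2 * (Real.sqrt (μ / L) ^ 2 * ‖u 0 - xs‖ ^ 2) = μ / 2 * ‖u 0 - xs‖ ^ 2 := by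
      linear_combination (‖u 0 - xs‖ ^ 2 / 2) * hμe
    rw [e, norm_sub_rev]
    have h5 : (L - μ) / 2 * ‖xs - start‖ ^ 2 ≤ (L - μ) / 2 * D ^ 2 :=
      mul_le_mul_of_nonneg_left h3 (by linarith)
    have h6 : μ / 2 * ‖xs - u 0‖ ^ 2 ≤ L / 2 * ‖xs - u 0‖ ^ 2 := by gcongr
    nlinarith [sq_nonneg D]
  have h5 := (hP.neg_mem_subdiffH (hG.grad xs) hxs hmin).2 (u t) (h.mem_dom ht)
  have h6 := hG.lower xs (hU.dom_subset hxs) (u t) (hU.dom_subset (h.mem_dom ht))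
  rw [inner_neg_left] at h5
  have h7 : 0 ≤ L / 2 * ‖(1 + Real.sqrt (μ / L)) • w t - u t - Real.sqrt (μ / L) • xs‖ ^ 2 := by
    positivity
  have h8 := mul_le_mul_of_nonneg_left h4 (pow_nonneg (sub_nonneg.mpr hα1) t)
  have h9 : μ / 2 * ‖u t - xs‖ ^ 2 ≤ (1 - Real.sqrt (μ / L)) ^ t * (L / 2 * D ^ 2) := by linarith
  have e : (1 - Real.sqrt (μ / L)) ^ t * (L / μ * D ^ 2) =
      (2 / μ) * ((1 - Real.sqrt (μ / L)) ^ t * (L / 2 * D ^ 2)) := by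
    field_simp
  rw [e]
  calc ‖u t - xs‖ ^ 2 = (2 / μ) * (μ / 2 * ‖u t - xs‖ ^ 2) := by field_simp
    _ ≤ _ := by gcongr

lemma apgStop_of_pow_le (h : IsAPGSeq P G μ L start T u w) (hP : P.Standing κ)
    (hU : Admissible P κ U) (hG : QuadModel U G G' μ L) (hμ : 0 < μ) (hμL : μ ≤ L)
    (hstart : start ∈ P.dom) (hD : ∀ z ∈ P.dom, ∀ z' ∈ P.dom, ‖z - z'‖ ≤ D) (hδ : 0 < δ)
    {t : ℕ} (ht : t + 2 ≤ T)
    (hpow : (1 - Real.sqrt (μ / L)) ^ t * (64 * L ^ 3 * D ^ 2 / μ) ≤ δ ^ 2) :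
    P.APGStop G δ (u (t + 2)) := by
  have hL := hμ.trans_le hμL
  have hα1 : Real.sqrt (μ / L) ≤ 1 := Real.sqrt_le_one.mpr ((div_le_one hL).mpr hμL)
  have hα0 := Real.sqrt_nonneg (μ / L)
  obtain ⟨xs, hxs, hmin⟩ := hP.exists_min (s := G)
    (continuous_iff_continuousAt.mpr fun x => (hG.grad x).continuousAt)
  have hLμ : 0 ≤ L / μ * D ^ 2 := by positivity
  -- Common radius around the minimiser for all iterates from `t` on. Three of them are needed,
  -- since `u (t + 2)` is computed from `w (t + 1)`, which involves `u (t + 1)` and `u t`; hence the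
  -- shift by `2`.
  set r := Real.sqrt ((1 - Real.sqrt (μ / L)) ^ t * (L / μ * D ^ 2)) with hr
  have hr0 : 0 ≤ r := Real.sqrt_nonneg _
  have hrsq : r ^ 2 = (1 - Real.sqrt (μ / L)) ^ t * (L / μ * D ^ 2) :=
    Real.sq_sqrt (mul_nonneg (pow_nonneg (sub_nonneg.mpr hα1) t) hLμ)
  have hdist : ∀ s, t ≤ s → s ≤ T → ‖u s - xs‖ ≤ r := fun s hs hsT => by
    refine Real.le_sqrt_of_sq_le ((h.dist_sq_le hP hU hG hμ hμL hstart hD hxs hmin hsT).trans ?_)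
    exact mul_le_mul_of_nonneg_right
      (pow_le_pow_of_le_one (by linarith) (by linarith) hs) hLμ
  obtain ⟨θ, hθ0, hθ1, hw⟩ := h.exists_extrapolate hμ hμL (t := t + 1) (by omega)
  have hmove : ‖u (t + 2) - w (t + 1)‖ ≤ 4 * r := by
    have e : u (t + 2) - w (t + 1) =
        (u (t + 2) - xs) - (u (t + 1) - xs) - θ • ((u (t + 1) - xs) - (u t - xs)) := by
      rw [hw, Nat.add_sub_cancel]; module
    have d0 := hdist t le_rfl (by omega)
    have d1 := hdist (t + 1) (by omega) (by omega)
    have d2 := hdist (t + 2) (by omega) ht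
    have n1 := norm_sub_le (u (t + 2) - xs) (u (t + 1) - xs)
    have n2 := norm_sub_le ((u (t + 2) - xs) - (u (t + 1) - xs))
      (θ • ((u (t + 1) - xs) - (u t - xs)))
    have n3 := norm_sub_le (u (t + 1) - xs) (u t - xs)
    rw [norm_smul, Real.norm_of_nonneg hθ0] at n2
    rw [e]
    have n4 : θ * ‖(u (t + 1) - xs) - (u t - xs)‖ ≤ 1 * ‖(u (t + 1) - xs) - (u t - xs)‖ := by
      gcongr
    linarith
  have hstep := h.step (t + 1) (by omega)
  refine (Metric.infEDist_le_edist_of_mem (hstep.neg_mem_subdiffH hP)).trans ?_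
  rw [edist_dist]
  refine ENNReal.ofReal_le_ofReal ?_
  rw [(hG.grad _).gradient, (hG.grad _).gradient, dist_eq_norm]
  have e : -G' (u (t + 2)) - -(G' (w (t + 1)) + L • (u (t + 1 + 1) - w (t + 1))) =
      L • (u (t + 2) - w (t + 1)) - (G' (u (t + 2)) - G' (w (t + 1))) := by
    rw [show t + 1 + 1 = t + 2 from rfl]; abel
  rw [e]
  have l1 := hG.lip _ (h.w_mem hU hμ hμL (t := t + 1) (by omega)) _
    (hU.dom_subset (h.mem_dom ht))
  have l2 := norm_sub_le (L • (u (t + 2) - w (t + 1))) (G' (u (t + 2)) - G' (w (t + 1)))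
  rw [norm_smul, Real.norm_of_nonneg hL.le] at l2
  -- The residual at `u (t + 2)` is at most `2 L ‖u (t + 2) - w (t + 1)‖ ≤ 8 L r`; squaring this
  -- produces the constant `64 L³ D² / μ`.
  have l3 : 8 * L * r ≤ δ := by
    refine abs_le_of_sq_le_sq' ?_ hδ.le |>.2
    calc (8 * L * r) ^ 2 = 64 * L ^ 2 * r ^ 2 := by ring
      _ = (1 - Real.sqrt (μ / L)) ^ t * (64 * L ^ 3 * D ^ 2 / μ) := by
        rw [hrsq]
        field_simp
      _ ≤ δ ^ 2 := hpow
  have l4 : L * ‖u (t + 2) - w (t + 1)‖ ≤ L * (4 * r) := by gcongr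
  linarith

lemma apgStop (h : IsAPGSeq P G μ L start T u w) (hP : P.Standing κ)
    (hU : Admissible P κ U) (hG : QuadModel U G G' μ L) (hμ : 0 < μ) (hμL : μ ≤ L)
    (hstart : start ∈ P.dom) (hD : ∀ z ∈ P.dom, ∀ z' ∈ P.dom, ‖z - z'‖ ≤ D) (hδ : 0 < δ)
    {t : ℕ} (ht : t + 2 ≤ T)
    (hlog : Real.sqrt (L / μ) * Real.log (1 + 64 * L ^ 3 * D ^ 2 / (μ * δ ^ 2)) ≤ t) :
    P.APGStop G δ (u (t + 2)) := by
  refine h.apgStop_of_pow_le hP hU hG hμ hμL hstart hD hδ ht ?_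
  have hL := hμ.trans_le hμL
  have hα1 : Real.sqrt (μ / L) ≤ 1 := Real.sqrt_le_one.mpr ((div_le_one hL).mpr hμL)
  have hα0 : 0 < Real.sqrt (μ / L) := Real.sqrt_pos.mpr (by positivity)
  have hinv : Real.sqrt (L / μ) = (Real.sqrt (μ / L))⁻¹ := by
    rw [← Real.sqrt_inv, inv_div]
  set α := Real.sqrt (μ / L) with hα
  set Q := 64 * L ^ 3 * D ^ 2 / (μ * δ ^ 2) with hQ
  have hQ0 : 0 ≤ Q := by positivity
  have h1 : Real.log (1 + Q) ≤ α * t := by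
    rw [hinv] at hlog
    calc Real.log (1 + Q) = α * (α⁻¹ * Real.log (1 + Q)) := by field_simp
      _ ≤ α * t := by gcongr
  -- `1 - α ≤ exp (-α)`; using `1 + Q` instead of `Q` keeps the logarithm nonnegative.
  have h2 : (1 - α) ^ t ≤ (1 + Q)⁻¹ := by
    calc (1 - α) ^ t ≤ Real.exp (-α) ^ t := by
          refine pow_le_pow_left₀ (by linarith) ?_ t
          linarith [Real.add_one_le_exp (-α)]
      _ = Real.exp (-(α * t)) := by rw [← Real.exp_nat_mul]; ring_nf
      _ ≤ Real.exp (-Real.log (1 + Q)) := Real.exp_le_exp.mpr (by linarith)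
      _ = (1 + Q)⁻¹ := by rw [Real.exp_neg, Real.exp_log (by linarith)]
  have e : 64 * L ^ 3 * D ^ 2 / μ = Q * δ ^ 2 := by
    rw [hQ]; field_simp
  rw [e]
  calc (1 - α) ^ t * (Q * δ ^ 2) ≤ (1 + Q)⁻¹ * (Q * δ ^ 2) := by gcongr
    _ = (Q / (1 + Q)) * δ ^ 2 := by ring
    _ ≤ 1 * δ ^ 2 := by
      gcongr
      exact (div_le_one (by linarith)).mpr (by linarith)
    _ = δ ^ 2 := one_mul _

end IsAPGSeq

lemma Standing.exists_isAPGSeq (hP : P.Standing κ) (G : Vec n → ℝ) (μ L : ℝ) (start : Vec n) :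
    ∃ u w, ∀ T, IsAPGSeq P G μ L start T u w := by
  choose prox hprox using hP.exists_proxGradStep G L
  let θ := (1 - Real.sqrt (μ / L)) / (1 + Real.sqrt (μ / L))
  let st : ℕ → Vec n × Vec n := fun t => Nat.rec (prox start, prox start)
    (fun _ s => (prox s.2, prox s.2 + θ • (prox s.2 - s.1))) t
  exact ⟨fun t => (st t).1, fun t => (st t).2, fun T =>
    ⟨hprox start, rfl, fun t _ => hprox _, fun t _ => rfl⟩⟩

variable {G : Vec n → ℝ} {G' : Vec n → Vec n} {U : Set (Vec n)} {μ L δ D : ℝ}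
  {start out : Vec n} {T : ℕ}

lemma APGOutputs.mem_dom (h : P.APGOutputs G μ L δ start T out) : out ∈ P.dom := by
  obtain ⟨u, w, h0, _, h1, hT, _, _, rfl⟩ := h
  obtain ⟨T, rfl⟩ := Nat.exists_eq_succ_of_ne_zero hT.ne'
  exact (h1 T (Nat.lt_succ_self T)).1.1

lemma APGOutputs.apgStop (h : P.APGOutputs G μ L δ start T out) : P.APGStop G δ out := by
  obtain ⟨u, w, _, _, _, _, h, _, rfl⟩ := h
  exact h

lemma APGOutputs.le (h : P.APGOutputs G μ L δ start T out) (hP : P.Standing κ)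
    (hU : Admissible P κ U) (hG : QuadModel U G G' μ L) (hμ : 0 < μ) (hμL : μ ≤ L)
    (hstart : start ∈ P.dom) (hD : ∀ z ∈ P.dom, ∀ z' ∈ P.dom, ‖z - z'‖ ≤ D) (hδ : 0 < δ) :
    (T : ℝ) ≤ 3 + Real.sqrt (L / μ) * Real.log (1 + 64 * L ^ 3 * D ^ 2 / (μ * δ ^ 2)) := by
  obtain ⟨u, w, h0, hw, h1, hT, _, hns, rfl⟩ := h
  have hseq : IsAPGSeq P G μ L start T u w :=
    ⟨h0, hw, fun t ht => (h1 t ht).1, fun t ht => (h1 t ht).2⟩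
  set B := Real.sqrt (L / μ) * Real.log (1 + 64 * L ^ 3 * D ^ 2 / (μ * δ ^ 2)) with hB
  have hB0 : 0 ≤ B := by
    have hL := hμ.trans_le hμL
    refine mul_nonneg (Real.sqrt_nonneg _) (Real.log_nonneg ?_)
    have : 0 ≤ 64 * L ^ 3 * D ^ 2 / (μ * δ ^ 2) := by positivity
    linarith
  have hle : T ≤ ⌈B⌉₊ + 2 := by
    by_contra hlt
    exact hns (⌈B⌉₊ + 2) (by omega) (by omega)
      (hseq.apgStop hP hU hG hμ hμL hstart hD hδ (by omega) (Nat.le_ceil B))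
  have h2 : (T : ℝ) ≤ (⌈B⌉₊ : ℝ) + 2 := by exact_mod_cast hle
  have h3 := Nat.ceil_lt_add_one hB0
  linarith

lemma Standing.exists_APGOutputs (hP : P.Standing κ) (hU : Admissible P κ U)
    (hG : QuadModel U G G' μ L) (hμ : 0 < μ) (hμL : μ ≤ L) (hstart : start ∈ P.dom)
    (hδ : 0 < δ) : ∃ T out, P.APGOutputs G μ L δ start T out := by
  classical
  obtain ⟨D, hD⟩ := Metric.isBounded_iff.mp hP.dom_compact.isBounded
  obtain ⟨u, w, hseq⟩ := hP.exists_isAPGSeq G μ L start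
  have hex : ∃ t, 0 < t ∧ P.APGStop G δ (u t) :=
    ⟨_, by omega, (hseq _).apgStop hP hU hG hμ hμL hstart
      (fun z hz z' hz' => by rw [← dist_eq_norm]; exact hD hz hz') hδ le_rfl (Nat.le_ceil _)⟩
  refine ⟨Nat.find hex, _, u, w, (hseq 0).first, (hseq 0).w_zero,
    fun t ht => ⟨(hseq _).step t ht, (hseq _).extrapolate t ht⟩, (Nat.find_spec hex).1,
    (Nat.find_spec hex).2, fun t h0 ht hs => Nat.find_min hex ht ⟨h0, hs⟩, rfl⟩

end Problem
end IALM

/-! ### The inexact proximal point method: descent, stationarity and cost. -/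

namespace IALM
namespace Problem

variable {n l : ℕ} {P : Problem n l} {κ : Constants l} {U : Set (Vec n)} {φ : Vec n → ℝ}
  {φ' : Vec n → Vec n} {ρ Lφ ε D m : ℝ} {x x' start : Vec n} {T : ℕ}

/-- The distance need not be known to be attained, so a slightly larger radius `r` buys an actual
subgradient. -/
lemma APGStop.exists_mem {G : Vec n → ℝ} {δ r : ℝ} (h : P.APGStop G δ x) (hδ : δ < r)
    (hr : 0 < r) : ∃ ξ ∈ P.subdiffH x, ‖ξ + gradient G x‖ ≤ r := by
  have h1 : Metric.infEDist (-(gradient G x)) (P.subdiffH x) < ENNReal.ofReal r :=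
    lt_of_le_of_lt h ((ENNReal.ofReal_lt_ofReal_iff hr).mpr hδ)
  obtain ⟨ξ, hξ, h2⟩ := Metric.infEDist_lt_iff.mp h1
  refine ⟨ξ, hξ, ?_⟩
  rw [edist_dist, ENNReal.ofReal_lt_ofReal_iff hr, dist_comm, dist_eq_norm, sub_neg_eq_add] at h2
  exact h2.le

lemma _root_.IALM.QuadModel.prox (hφ : QuadModel U φ φ' (-ρ) Lφ) (hρ : 0 ≤ ρ) (x : Vec n) :
    QuadModel U (fun z => φ z + ρ * ‖z - x‖ ^ 2) (fun z => φ' z + (2 * ρ) • (z - x)) ρ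
      (Lφ + 2 * ρ) :=
  (hφ.add_prox hρ x).mono (by linarith) le_rfl

/-- The coefficient `3/2 ρ` is `ρ` from the proximal term plus `ρ/2` from strong convexity of the
subproblem. The radius `r` is left free: it is chosen proportional to the step for the descent, and
equal to `ε` for the last step. -/
lemma APGOutputs.prox_descent
    (h : P.APGOutputs (fun z => φ z + ρ * ‖z - x‖ ^ 2) ρ (Lφ + 2 * ρ) (ε / 4) start T x')
    (hU : Admissible P κ U) (hφ : QuadModel U φ φ' (-ρ) Lφ) (hρ : 0 ≤ ρ) (hx : x ∈ P.dom)
    {r : ℝ} (hr : ε / 4 < r) (hr0 : 0 < r) :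
    φ x' + P.h x' + 3 / 2 * ρ * ‖x' - x‖ ^ 2 ≤ φ x + P.h x + r * ‖x' - x‖ := by
  have hG := hφ.prox hρ x
  obtain ⟨ξ, hξ, hn⟩ := h.apgStop.exists_mem hr hr0
  rw [(hG.grad x').gradient] at hn
  have h1 := hξ.2 x hx
  have h2 := hG.lower x' (hU.dom_subset h.mem_dom) x (hU.dom_subset hx)
  have h3 := (abs_le.mp (abs_real_inner_le_norm (ξ + (φ' x' + (2 * ρ) • (x' - x))) (x - x'))).1
  rw [inner_add_left] at h3
  have h4 := mul_le_mul_of_nonneg_right hn (norm_nonneg (x - x'))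
  simp only [sub_self, norm_zero] at h2
  rw [norm_sub_rev x x'] at h2 h3 h4
  linarith

/-- `z` and `T` describe the first `S` iterations of iPPM. -/
structure IsIPPMSeq (P : Problem n l) (φ : Vec n → ℝ) (ρ Lφ ε : ℝ) (start : ℕ → Vec n) (S : ℕ)
    (z : ℕ → Vec n) (T : ℕ → ℕ) : Prop where
  first : z 0 ∈ P.dom
  step : ∀ j < S, P.APGOutputs (fun x => φ x + ρ * ‖x - z j‖ ^ 2) ρ (Lφ + 2 * ρ) (ε / 4)
    (start j) (T j) (z (j + 1))
  not_stopped : ∀ j < S, ¬ (2 * ρ * ‖z (j + 1) - z j‖ ≤ ε / 2)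

lemma IsIPPMSeq.mem_dom {start : ℕ → Vec n} {S : ℕ} {z : ℕ → Vec n} {T : ℕ → ℕ}
    (h : IsIPPMSeq P φ ρ Lφ ε start S z T) {j : ℕ} (hj : j ≤ S) : z j ∈ P.dom := by
  cases j with
  | zero => exact h.first
  | succ j => exact (h.step j hj).mem_dom

lemma IsIPPMSeq.descent {start : ℕ → Vec n} {S : ℕ} {z : ℕ → Vec n} {T : ℕ → ℕ}
    (h : IsIPPMSeq P φ ρ Lφ ε start S z T) (hU : Admissible P κ U)
    (hφ : QuadModel U φ φ' (-ρ) Lφ) (hρ : 0 < ρ) (hε : 0 < ε) {j : ℕ} (hj : j ≤ S) :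
    φ (z j) + P.h (z j) + j * (ε ^ 2 / (32 * ρ)) ≤ φ (z 0) + P.h (z 0) := by
  induction j with
  | zero => simp
  | succ j ih =>
    have ih := ih (by omega)
    have hns := h.not_stopped j hj
    rw [not_le] at hns
    set d := ‖z (j + 1) - z j‖ with hd
    have hd' : ε / 4 < ρ * d := by linarith
    -- Taking `r = ρ d`, which exceeds `ε/4` because the test failed, leaves a net decrease `ρ d²/2
    -- ≥ ε²/(32ρ)`.
    have h1 := (h.step j hj).prox_descent hU hφ hρ.le (h.mem_dom (by omega)) hd'
      ((by positivity : (0 : ℝ) < ε / 4).trans hd')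
    rw [← hd] at h1
    have h2 : ε ^ 2 / (32 * ρ) ≤ ρ * d ^ 2 / 2 := by
      rw [div_le_iff₀ (by positivity)]
      nlinarith
    push_cast
    linarith

lemma IsIPPMSeq.card_le {start : ℕ → Vec n} {S : ℕ} {z : ℕ → Vec n} {T : ℕ → ℕ}
    (h : IsIPPMSeq P φ ρ Lφ ε start S z T) (hU : Admissible P κ U)
    (hφ : QuadModel U φ φ' (-ρ) Lφ) (hρ : 0 < ρ) (hε : 0 < ε)
    (hm : ∀ x ∈ P.dom, m ≤ φ x + P.h x) :
    (S : ℝ) ≤ 32 * ρ * (φ (z 0) + P.h (z 0) - m) / ε ^ 2 := by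
  have h1 := h.descent hU hφ hρ hε le_rfl
  have h2 := hm _ (h.mem_dom le_rfl)
  have h3 : (S : ℝ) * (ε ^ 2 / (32 * ρ)) ≤ φ (z 0) + P.h (z 0) - m := by linarith
  rw [le_div_iff₀ (by positivity)]
  rw [← mul_div_assoc, div_le_iff₀ (by positivity)] at h3
  linarith

namespace IPPMOutputs

variable {start : ℕ → Vec n} {N : ℕ} {x₀ out : Vec n}

lemma mem_dom (h : P.IPPMOutputs φ x₀ ρ Lφ ε start N out) : out ∈ P.dom := by
  obtain ⟨S, z, T, _, h1, _, _, rfl, _⟩ := h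
  exact (h1 S le_rfl).mem_dom

/-- All steps but the last decrease the objective; the last may be short, and then the inexactness
costs at most `ε` times the diameter. -/
lemma value_le (h : P.IPPMOutputs φ x₀ ρ Lφ ε start N out) (hU : Admissible P κ U)
    (hφ : QuadModel U φ φ' (-ρ) Lφ) (hρ : 0 < ρ) (hε : 0 < ε)
    (hD : ∀ z ∈ P.dom, ∀ z' ∈ P.dom, ‖z - z'‖ ≤ D) (hx₀ : x₀ ∈ P.dom) :
    φ out + P.h out ≤ φ x₀ + P.h x₀ + ε * D := by
  obtain ⟨S, z, T, rfl, h1, h2, _, rfl, _⟩ := h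
  have hseq : IsIPPMSeq P φ ρ Lφ ε start S z T := ⟨hx₀, fun j hj => h1 j hj.le, h2⟩
  have h3 := hseq.descent hU hφ hρ hε le_rfl
  have h4 := (h1 S le_rfl).prox_descent hU hφ hρ.le (hseq.mem_dom le_rfl)
    (by linarith : ε / 4 < ε) hε
  have h5 := mul_le_mul_of_nonneg_left
    (hD _ (h1 S le_rfl).mem_dom _ (hseq.mem_dom le_rfl)) hε.le
  have h6 : 0 ≤ (S : ℝ) * (ε ^ 2 / (32 * ρ)) := by positivity
  have h7 : 0 ≤ 3 / 2 * ρ * ‖z (S + 1) - z S‖ ^ 2 := by positivity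
  linarith

lemma exists_mem_subdiffH (h : P.IPPMOutputs φ x₀ ρ Lφ ε start N out)
    (hφ : QuadModel U φ φ' (-ρ) Lφ) (hρ : 0 < ρ) (hε : 0 < ε) :
    ∃ ξ ∈ P.subdiffH out, ‖ξ + φ' out‖ ≤ ε := by
  obtain ⟨S, z, T, rfl, h1, _, h3, rfl, _⟩ := h
  have hG := hφ.prox hρ.le (z S)
  obtain ⟨ξ, hξ, hn⟩ := (h1 S le_rfl).apgStop.exists_mem (by linarith : ε / 4 < ε / 2) (by linarith)
  refine ⟨ξ, hξ, ?_⟩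
  rw [(hG.grad _).gradient] at hn
  -- Removing the proximal gradient costs `ε/2` by the stopping test; the other `ε/2` is the APG
  -- residual.
  have e : ξ + φ' (z (S + 1)) = (ξ + (φ' (z (S + 1)) + (2 * ρ) • (z (S + 1) - z S))) -
      (2 * ρ) • (z (S + 1) - z S) := by abel
  rw [e]
  refine (norm_sub_le _ _).trans ?_
  rw [norm_smul, Real.norm_of_nonneg (by positivity : 0 ≤ 2 * ρ)]
  linarith

lemma card_le (h : P.IPPMOutputs φ x₀ ρ Lφ ε start N out) (hP : P.Standing κ)
    (hU : Admissible P κ U) (hφ : QuadModel U φ φ' (-ρ) Lφ) (hρ : 0 < ρ) (hL : 0 ≤ Lφ)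
    (hε : 0 < ε) (hD : ∀ z ∈ P.dom, ∀ z' ∈ P.dom, ‖z - z'‖ ≤ D)
    (hm : ∀ x ∈ P.dom, m ≤ φ x + P.h x) (hx₀ : x₀ ∈ P.dom) (hstart : ∀ j, start j ∈ P.dom) :
    (N : ℝ) ≤ (1 + 32 * ρ * (φ x₀ + P.h x₀ - m) / ε ^ 2) *
      (3 + Real.sqrt ((Lφ + 2 * ρ) / ρ) *
        Real.log (1 + 64 * (Lφ + 2 * ρ) ^ 3 * D ^ 2 / (ρ * (ε / 4) ^ 2))) := by
  obtain ⟨S, z, T, rfl, h1, h2, _, rfl, rfl⟩ := h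
  have hseq : IsIPPMSeq P φ ρ Lφ ε start S z T := ⟨hx₀, fun j hj => h1 j hj.le, h2⟩
  have hS := hseq.card_le hU hφ hρ hε hm
  set B := 3 + Real.sqrt ((Lφ + 2 * ρ) / ρ) *
        Real.log (1 + 64 * (Lφ + 2 * ρ) ^ 3 * D ^ 2 / (ρ * (ε / 4) ^ 2)) with hB
  have hT : ∀ j ∈ Finset.range (S + 1), (T j : ℝ) ≤ B := fun j hj =>
    (h1 j (Nat.lt_succ_iff.mp (Finset.mem_range.mp hj))).le hP hU (hφ.prox hρ.le (z j)) hρ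
      (by linarith) (hstart j) hD (by positivity)
  have hB0 : 0 ≤ B := (Nat.cast_nonneg _).trans (hT 0 (by simp))
  push_cast
  calc ∑ j ∈ Finset.range (S + 1), (T j : ℝ) ≤ ∑ j ∈ Finset.range (S + 1), B :=
        Finset.sum_le_sum hT
    _ = (1 + S) * B := by
      rw [Finset.sum_const, Finset.card_range, nsmul_eq_mul]
      push_cast
      ring
    _ ≤ _ := by gcongr

end IPPMOutputs

lemma Standing.exists_IPPMOutputs (hP : P.Standing κ) (hU : Admissible P κ U)
    (hφ : QuadModel U φ φ' (-ρ) Lφ) (hρ : 0 < ρ) (hL : 0 ≤ Lφ) (hε : 0 < ε) (hx : x ∈ P.dom)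
    {start : ℕ → Vec n} (hstart : ∀ j, start j ∈ P.dom) :
    ∃ N out, P.IPPMOutputs φ x ρ Lφ ε start N out := by
  classical
  have hex : ∀ (j : ℕ) (z : Vec n), ∃ T out,
      P.APGOutputs (fun x => φ x + ρ * ‖x - z‖ ^ 2) ρ (Lφ + 2 * ρ) (ε / 4) (start j) T out :=
    fun j z => hP.exists_APGOutputs hU (hφ.prox hρ.le z) hρ (by linarith) (hstart j) (by positivity)
  choose T out hout using hex
  let z : ℕ → Vec n := fun j => Nat.rec x (fun j z => out j z) j
  have hz : ∀ j, P.APGOutputs (fun x => φ x + ρ * ‖x - z j‖ ^ 2) ρ (Lφ + 2 * ρ) (ε / 4)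
    (start j) (T j (z j)) (z (j + 1)) := fun j => hout j (z j)
  obtain ⟨xm, _, hmin⟩ := hP.exists_min (s := φ)
    (continuous_iff_continuousAt.mpr fun x => (hφ.grad x).continuousAt)
  -- An endless loop would lower the objective by a fixed amount each time, below its minimum.
  have h_term : ∃ j, 2 * ρ * ‖z (j + 1) - z j‖ ≤ ε / 2 := by
    by_contra! hns
    obtain ⟨S, hS⟩ := exists_nat_gt
      (32 * ρ * (φ (z 0) + P.h (z 0) - (φ xm + P.h xm)) / ε ^ 2)
    have hseq : IsIPPMSeq P φ ρ Lφ ε start S z (fun j => T j (z j)) :=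
      ⟨hx, fun j _ => hz j, fun j _ => not_le.mpr (hns j)⟩
    exact (hseq.card_le hU hφ hρ hε hmin).not_gt hS
  exact ⟨_, _, Nat.find h_term, z, fun j => T j (z j), rfl, fun j _ => hz j,
    fun j hj => Nat.find_min h_term hj, Nat.find_spec h_term, rfl, rfl⟩

end Problem
end IALM

/-! ### Outer iterations: multipliers, feasibility and objective gaps. -/

namespace IALM

variable {n l : ℕ} {P : Problem n l} {κ : Constants l} {U : Set (Vec n)} {a : Params}
  {ε v F : ℝ} {x₀ : Vec n} {start : ℕ → ℕ → Vec n} {K : ℕ} {x : ℕ → Vec n} {y : ℕ → Vec l}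
  {N : ℕ → ℕ}

/-- Bounds over `dom h`: `D` for its diameter, `Bc` for `‖c‖`, `BJ` for `‖J_cᵀ‖`, `Bg` for
`‖∇g‖`, and a lower bound `m` for `g + h`. -/
structure DomBounds (P : Problem n l) (D Bc BJ Bg m : ℝ) : Prop where
  D_nonneg : 0 ≤ D
  Bc_nonneg : 0 ≤ Bc
  BJ_nonneg : 0 ≤ BJ
  Bg_nonneg : 0 ≤ Bg
  diam : ∀ z ∈ P.dom, ∀ z' ∈ P.dom, ‖z - z'‖ ≤ D
  c_le : ∀ z ∈ P.dom, ‖P.c z‖ ≤ Bc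
  jacT_le : ∀ z ∈ P.dom, ∀ y, ‖P.jacT z y‖ ≤ BJ * ‖y‖
  grad_le : ∀ z ∈ P.dom, ‖gradient P.g z‖ ≤ Bg
  le_value : ∀ z ∈ P.dom, m ≤ P.g z + P.h z

namespace Problem

lemma BoundsOn.B_nonneg (hB : P.BoundsOn κ P.dom) (hP : P.Standing κ) (i : Fin l) :
    0 ≤ κ.B i := by
  obtain ⟨z, hz⟩ := hP.dom_nonempty
  exact (abs_nonneg _).trans (hB i z hz).1

lemma Standing.exists_domBounds (hP : P.Standing κ) (hB : P.BoundsOn κ P.dom) :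
    ∃ D Bc BJ Bg m, DomBounds P D Bc BJ Bg m := by
  obtain ⟨z₀, hz₀⟩ := hP.dom_nonempty
  obtain ⟨D, hD⟩ := Metric.isBounded_iff.mp hP.dom_compact.isBounded
  obtain ⟨Bc, hBc⟩ := hP.dom_compact.exists_bound_of_continuousOn
    hP.differentiable_c.continuous.continuousOn
  have hcont : Continuous (gradient P.g) := by
    refine (LipschitzWith.of_dist_le_mul (K := ⟨κ.L₀, hP.L₀_nonneg⟩) fun z z' => ?_).continuous
    rw [dist_eq_norm, dist_eq_norm]
    exact hP.g_smooth.2 z z'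
  obtain ⟨Bg, hBg⟩ := hP.dom_compact.exists_bound_of_continuousOn hcont.continuousOn
  obtain ⟨xm, _, hm⟩ := hP.exists_min hP.g_smooth.1.continuous
  refine ⟨D, Bc, ∑ i, κ.B i, Bg, _, ?_, (norm_nonneg _).trans (hBc z₀ hz₀),
    Finset.sum_nonneg fun i _ => hB.B_nonneg hP i, (norm_nonneg _).trans (hBg z₀ hz₀),
    fun z hz z' hz' => ?_, hBc, fun z hz y => ?_, hBg, hm⟩
  · exact dist_nonneg.trans (hD hz₀ hz₀)
  · rw [← dist_eq_norm]
    exact hD hz hz'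
  · rw [hP.jacT_eq, Finset.sum_mul]
    refine norm_sum_le_of_le _ fun i _ => ?_
    rw [norm_smul, mul_comm]
    exact mul_le_mul (hB i z hz).2 (PiLp.norm_apply_le y i) (norm_nonneg _) (hB.B_nonneg hP i)

end Problem

lemma Constants.ρc_nonneg (hP : P.Standing κ) (hB : P.BoundsOn κ P.dom) : 0 ≤ κ.ρc :=
  Finset.sum_nonneg fun i _ => mul_nonneg (hB.B_nonneg hP i) (hP.ρ_nonneg i)

lemma Constants.Lc_nonneg (hP : P.Standing κ) (hB : P.BoundsOn κ P.dom) : 0 ≤ κ.Lc :=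
  Finset.sum_nonneg fun i _ => add_nonneg (mul_nonneg (hB.B_nonneg hP i) (hP.L_nonneg i))
    (sq_nonneg _)

lemma Constants.Lbar_nonneg : 0 ≤ κ.Lbar := Real.sqrt_nonneg _

lemma Constants.Lhat_nonneg (hP : P.Standing κ) (hB : P.BoundsOn κ P.dom) {β : ℝ} (hβ : 0 ≤ β)
    (y : Vec l) : 0 ≤ κ.Lhat β y :=
  add_nonneg (add_nonneg hP.L₀_nonneg (mul_nonneg κ.Lbar_nonneg (norm_nonneg y)))
    (mul_nonneg hβ (κ.Lc_nonneg hP hB))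

lemma Constants.le_ρhat (hP : P.Standing κ) (hB : P.BoundsOn κ P.dom) {β₀ β : ℝ} (hβ : β₀ ≤ β)
    (y : Vec l) : κ.ρ₀ + β₀ * κ.ρc ≤ κ.ρhat β y := by
  have h1 := mul_le_mul_of_nonneg_right hβ (κ.ρc_nonneg hP hB)
  have h2 := mul_nonneg κ.Lbar_nonneg (norm_nonneg y)
  rw [Constants.ρhat]
  linarith

lemma Params.le_β (hβ : 0 < a.β₀) (hσ : 1 < a.σ) (k : ℕ) : a.β₀ ≤ a.β k :=
  le_mul_of_one_le_right hβ.le (one_le_pow₀ hσ.le)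

lemma Params.β_pos (hβ : 0 < a.β₀) (hσ : 1 < a.σ) (k : ℕ) : 0 < a.β k :=
  hβ.trans_le (Params.le_β hβ hσ k)

lemma Params.β_succ (a : Params) (k : ℕ) : a.β (k + 1) = a.σ * a.β k := by
  rw [Params.β, Params.β, pow_succ]; ring

namespace IsRun

lemma norm_y_le (h : IsRun P κ a ε x₀ start K x y N) (hM : 0 ≤ a.M) {k : ℕ} (hk : k ≤ K) :
    ‖y k‖ ≤ a.M * (k : ℝ) ^ (a.q + 1) := by
  induction k with
  | zero => simp [h.y_zero]
  | succ k ih =>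
    have ih := ih (by omega)
    rw [h.y_step k hk]
    refine (norm_add_le _ _).trans ?_
    have h1 : ‖(a.M * ((k : ℝ) + 1) ^ a.q / ‖P.c (x (k + 1))‖) • P.c (x (k + 1))‖ ≤
        a.M * ((k : ℝ) + 1) ^ a.q := by
      rw [norm_smul, Real.norm_of_nonneg (by positivity)]
      rw [div_mul_eq_mul_div, mul_div_assoc]
      -- The ratio `‖c‖/‖c‖` is at most `1` also when `c = 0`, since `0/0 = 0`.
      exact mul_le_of_le_one_right (by positivity) (div_self_le_one _)
    have h2 : (k : ℝ) ^ (a.q + 1) ≤ k * ((k : ℝ) + 1) ^ a.q := by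
      rw [pow_succ']
      gcongr
      linarith
    have h3 := mul_le_mul_of_nonneg_left h2 hM
    push_cast
    rw [pow_succ']
    nlinarith

lemma mem_dom (h : IsRun P κ a ε x₀ start K x y N) (hx₀ : x₀ ∈ P.dom) {k : ℕ} (hk : k ≤ K) :
    x k ∈ P.dom := by
  cases k with
  | zero => exact h.x_zero ▸ hx₀
  | succ k => exact (h.x_step k hk).mem_dom

variable {D Bc BJ Bg m : ℝ}

lemma exists_stationary (h : IsRun P κ a ε x₀ start K x y N) (hP : P.Standing κ)
    (hU : P.Admissible κ U) (hβ : 0 < a.β₀) (hσ : 1 < a.σ) (hρ : 0 < κ.ρ₀ + a.β₀ * κ.ρc)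
    (hε : 0 < ε) {k : ℕ} (hk : k < K) :
    ∃ ξ ∈ P.subdiffH (x (k + 1)), ‖ξ + P.gradAL (a.β k) (y k) (x (k + 1))‖ ≤ ε :=
  (h.x_step k hk).exists_mem_subdiffH (hU.quadModel hP (Params.β_pos hβ hσ k).le (y k))
    (hρ.trans_le (κ.le_ρhat hP hU.bounds (Params.le_β hβ hσ k) (y k))) hε

lemma isKKT (h : IsRun P κ a ε x₀ start K x y N) (hP : P.Standing κ)
    (hU : P.Admissible κ U) (hβ : 0 < a.β₀) (hσ : 1 < a.σ) (hρ : 0 < κ.ρ₀ + a.β₀ * κ.ρc)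
    (hε : 0 < ε) {k : ℕ} (hk : k < K) (hc : ‖P.c (x (k + 1))‖ ≤ ε) : P.IsKKT ε (x (k + 1)) := by
  obtain ⟨ξ, hξ, hn⟩ := h.exists_stationary hP hU hβ hσ hρ hε hk
  -- With this multiplier the gradient of the Lagrangian equals that of the augmented Lagrangian.
  refine ⟨y k + a.β k • P.c (x (k + 1)), hc, ?_⟩
  have hmem : (gradient P.g (x (k + 1)) + ξ) +
      P.jacT (x (k + 1)) (y k + a.β k • P.c (x (k + 1))) ∈
      P.subdiffF (x (k + 1)) + {P.jacT (x (k + 1)) (y k + a.β k • P.c (x (k + 1)))} :=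
    Set.add_mem_add (Set.add_mem_add rfl hξ) rfl
  refine (Metric.infEDist_le_edist_of_mem hmem).trans ?_
  rw [edist_dist, dist_zero_left]
  refine ENNReal.ofReal_le_ofReal (le_trans (le_of_eq ?_) hn)
  rw [Problem.gradAL, Problem.jacT, map_add, map_smul]
  congr 1
  simp only [Problem.jacT]
  abel

/-- Regularity is tested on `ξ/β_k`, with `ξ` the approximate stationarity subgradient: the penalty
gradient cancels, and only the residual, `∇g` and `J_cᵀ y^k` remain. -/
lemma norm_c_le (h : IsRun P κ a ε x₀ start K x y N) (hP : P.Standing κ)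
    (hU : P.Admissible κ U) (hb : DomBounds P D Bc BJ Bg m) (hβ : 0 < a.β₀) (hσ : 1 < a.σ)
    (hρ : 0 < κ.ρ₀ + a.β₀ * κ.ρc) (hε : 0 < ε) (hx₀ : x₀ ∈ P.dom) {k : ℕ} (hk : k < K)
    (hreg : P.RegularAt v (a.β k) (x (k + 1))) :
    v * a.β k * ‖P.c (x (k + 1))‖ ≤ ε + Bg + BJ * ‖y k‖ := by
  obtain ⟨ξ, hξ, hn⟩ := h.exists_stationary hP hU hβ hσ hρ hε hk
  have hβk := Params.β_pos hβ hσ k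
  have hx := h.mem_dom hx₀ (k := k + 1) hk
  have h1 := hreg.trans (Metric.infEDist_le_edist_of_mem (Set.smul_mem_smul_set hξ))
  rw [edist_dist, ENNReal.ofReal_le_ofReal_iff dist_nonneg, dist_comm, dist_eq_norm,
    sub_neg_eq_add] at h1
  have e : (a.β k)⁻¹ • ξ + P.jacT (x (k + 1)) (P.c (x (k + 1))) = (a.β k)⁻¹ •
      ((ξ + P.gradAL (a.β k) (y k) (x (k + 1))) - gradient P.g (x (k + 1)) -
        P.jacT (x (k + 1)) (y k)) := by
    rw [Problem.gradAL]
    have : ξ + (gradient P.g (x (k + 1)) + P.jacT (x (k + 1)) (y k) +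
        a.β k • P.jacT (x (k + 1)) (P.c (x (k + 1)))) - gradient P.g (x (k + 1)) -
        P.jacT (x (k + 1)) (y k) = ξ + a.β k • P.jacT (x (k + 1)) (P.c (x (k + 1))) := by abel
    rw [this, smul_add, smul_smul, inv_mul_cancel₀ hβk.ne', one_smul]
  rw [e, norm_smul, norm_inv, Real.norm_of_nonneg hβk.le, ← div_eq_inv_mul,
    le_div_iff₀ hβk] at h1
  have h2 := norm_sub_le ((ξ + P.gradAL (a.β k) (y k) (x (k + 1))) - gradient P.g (x (k + 1)))
    (P.jacT (x (k + 1)) (y k))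
  have h3 := norm_sub_le (ξ + P.gradAL (a.β k) (y k) (x (k + 1))) (gradient P.g (x (k + 1)))
  have h4 := hb.grad_le _ hx
  have h5 := hb.jacT_le _ hx (y k)
  linarith

/-- A constant for the growth of the penalty terms and objective values along a run. -/
def _root_.IALM.Params.growth (a : Params) (v D Bc BJ Bg : ℝ) : ℝ :=
  a.β₀ * Bc ^ 2 + a.σ * Bc / v * (1 + Bg + BJ * a.M) + 2 * Bc * a.M + D

lemma growth_nonneg (hb : DomBounds P D Bc BJ Bg m) (hβ : 0 < a.β₀) (hσ : 1 < a.σ) (hM : 0 < a.M)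
    (hv : 0 < v) : 0 ≤ a.growth v D Bc BJ Bg := by
  have := hb.D_nonneg
  have := hb.Bc_nonneg
  have := hb.BJ_nonneg
  have := hb.Bg_nonneg
  have : 0 < a.σ := by linarith
  rw [Params.growth]
  positivity

/-- Bounds the possible increase of `f₀` in one outer iteration, without a factor `β_k`. For `k ≥
1`, write `β_k = σ β_{k-1}`: regularity at `x^k` bounds `β_{k-1}‖c(x^k)‖`, and `Bc` bounds the other
factor. At `k = 0` the penalty is the constant `β₀`. -/
lemma penalty_le (h : IsRun P κ a ε x₀ start K x y N) (hP : P.Standing κ)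
    (hU : P.Admissible κ U) (hb : DomBounds P D Bc BJ Bg m) (hβ : 0 < a.β₀) (hσ : 1 < a.σ)
    (hM : 0 < a.M) (hv : 0 < v) (hρ : 0 < κ.ρ₀ + a.β₀ * κ.ρc) (hε : 0 < ε) (hx₀ : x₀ ∈ P.dom)
    (hreg : ∀ k < K, P.RegularAt v (a.β k) (x (k + 1))) {k : ℕ} (hk : k ≤ K) :
    a.β k / 2 * ‖P.c (x k)‖ ^ 2 + 2 * Bc * ‖y k‖ + ε * D ≤
      a.growth v D Bc BJ Bg * ((1 + ε) * ((k : ℝ) + 1) ^ (a.q + 1)) := by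
  have hD := hb.D_nonneg
  have hBc := hb.Bc_nonneg
  have hBJ := hb.BJ_nonneg
  have hBg := hb.Bg_nonneg
  have hσ0 : 0 < a.σ := by linarith
  set R := (1 + ε) * ((k : ℝ) + 1) ^ (a.q + 1) with hR
  have hp1 : (1 : ℝ) ≤ ((k : ℝ) + 1) ^ (a.q + 1) := one_le_pow₀ (by linarith [k.cast_nonneg (α := ℝ)])
  have hp0 : (k : ℝ) ^ (a.q + 1) ≤ ((k : ℝ) + 1) ^ (a.q + 1) := by gcongr; linarith
  have hR1 : 1 + ε ≤ R := by rw [hR]; exact le_mul_of_one_le_right (by linarith) hp1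
  have hRk : (k : ℝ) ^ (a.q + 1) ≤ R := hp0.trans (by rw [hR]; nlinarith)
  have hy := h.norm_y_le hM.le hk
  have hc := hb.c_le _ (h.mem_dom hx₀ hk)
  have hmain : a.β k / 2 * ‖P.c (x k)‖ ^ 2 ≤
      a.β₀ * Bc ^ 2 * R + a.σ * Bc / v * ((1 + Bg + BJ * a.M) * R) := by
    cases k with
    | zero =>
      have e : a.β 0 = a.β₀ := by simp [Params.β]
      rw [e]
      have h1 : a.β₀ / 2 * ‖P.c (x 0)‖ ^ 2 ≤ a.β₀ * Bc ^ 2 := by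
        have : ‖P.c (x 0)‖ ^ 2 ≤ Bc ^ 2 := by gcongr
        nlinarith [sq_nonneg Bc]
      have h2 : a.β₀ * Bc ^ 2 ≤ a.β₀ * Bc ^ 2 * R :=
        le_mul_of_one_le_right (by positivity) (by linarith)
      have h3 : 0 ≤ a.σ * Bc / v * ((1 + Bg + BJ * a.M) * R) := by
        have : 0 ≤ R := by linarith
        positivity
      linarith
    | succ j =>
      have hj : j < K := hk
      have h1 := h.norm_c_le hP hU hb hβ hσ hρ hε hx₀ hj (hreg j hj)
      have hyj := h.norm_y_le hM.le hj.le
      have hjk : (j : ℝ) ^ (a.q + 1) ≤ R :=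
        le_trans (by push_cast; gcongr; linarith) hRk
      have h2 : ε + Bg + BJ * ‖y j‖ ≤ (1 + Bg + BJ * a.M) * R := by
        have e1 : Bg ≤ Bg * R := le_mul_of_one_le_right hBg (by linarith)
        have e2 : BJ * ‖y j‖ ≤ BJ * (a.M * R) := by
          refine mul_le_mul_of_nonneg_left (hyj.trans ?_) hBJ
          gcongr
        linarith
      have hβj := Params.β_pos hβ hσ j
      have h3 : a.β j * ‖P.c (x (j + 1))‖ ≤ (1 + Bg + BJ * a.M) * R / v := by
        rw [le_div_iff₀ hv]
        linarith
      have h4 : a.β (j + 1) / 2 * ‖P.c (x (j + 1))‖ ^ 2 =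
          a.σ / 2 * (a.β j * ‖P.c (x (j + 1))‖) * ‖P.c (x (j + 1))‖ := by
        rw [Params.β_succ]; ring
      have hX : 0 ≤ (1 + Bg + BJ * a.M) * R / v := le_trans (by positivity) h3
      have h5 : a.σ / 2 * (a.β j * ‖P.c (x (j + 1))‖) * ‖P.c (x (j + 1))‖ ≤
          a.σ / 2 * ((1 + Bg + BJ * a.M) * R / v) * Bc := by gcongr
      have h6 : a.σ / 2 * ((1 + Bg + BJ * a.M) * R / v) * Bc =
          (a.σ * Bc / v * ((1 + Bg + BJ * a.M) * R)) / 2 := by ring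
      have h7 : 0 ≤ a.σ * Bc / v * ((1 + Bg + BJ * a.M) * R) := by
        have : a.σ * Bc / v * ((1 + Bg + BJ * a.M) * R) =
          a.σ * Bc * ((1 + Bg + BJ * a.M) * R / v) := by ring
        rw [this]; positivity
      have h8 : 0 ≤ a.β₀ * Bc ^ 2 * R := by
        have : 0 ≤ R := by linarith
        positivity
      linarith
  have hy' : 2 * Bc * ‖y k‖ ≤ 2 * Bc * (a.M * R) := by
    refine mul_le_mul_of_nonneg_left (hy.trans ?_) (by positivity)
    gcongr
  have hD' : ε * D ≤ R * D := by gcongr; linarith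
  rw [Params.growth]
  linarith

/-- Compares the augmented Lagrangian at `x^k` and `x^{k+1}` for the same multiplier: the new
penalty term is dropped, the two dual terms cost `2 Bc ‖y^k‖`, and iPPM costs `ε D`. Summing over
`k` gives one more power of `k`. -/
lemma value_le (h : IsRun P κ a ε x₀ start K x y N) (hP : P.Standing κ)
    (hU : P.Admissible κ U) (hb : DomBounds P D Bc BJ Bg m) (hβ : 0 < a.β₀) (hσ : 1 < a.σ)
    (hM : 0 < a.M) (hv : 0 < v) (hρ : 0 < κ.ρ₀ + a.β₀ * κ.ρc) (hε : 0 < ε) (hx₀ : x₀ ∈ P.dom)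
    (hreg : ∀ k < K, P.RegularAt v (a.β k) (x (k + 1))) (hF : P.g x₀ + P.h x₀ ≤ F) {k : ℕ}
    (hk : k ≤ K) :
    P.g (x k) + P.h (x k) ≤
      F + a.growth v D Bc BJ Bg * (1 + ε) * (k * ((k : ℝ) + 1) ^ (a.q + 1)) := by
  induction k with
  | zero => simpa [h.x_zero] using hF
  | succ k ih =>
    have ih := ih (by omega)
    have hpen := h.penalty_le hP hU hb hβ hσ hM hv hρ hε hx₀ hreg (k := k) (by omega)
    have hdes := (h.x_step k hk).value_le hU
      (hU.quadModel hP (Params.β_pos hβ hσ k).le (y k))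
      (hρ.trans_le (κ.le_ρhat hP hU.bounds (Params.le_β hβ hσ k) (y k))) hε hb.diam
      (h.mem_dom hx₀ (by omega))
    simp only [Problem.smoothAL] at hdes
    have hi1 := (abs_le.mp (abs_real_inner_le_norm (y k) (P.c (x k)))).2
    have hi2 := (abs_le.mp (abs_real_inner_le_norm (y k) (P.c (x (k + 1))))).1
    have hc1 := mul_le_mul_of_nonneg_left (hb.c_le _ (h.mem_dom hx₀ (k := k) (by omega)))
      (norm_nonneg (y k))
    have hc2 := mul_le_mul_of_nonneg_left (hb.c_le _ (h.mem_dom hx₀ hk)) (norm_nonneg (y k))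
    have hp : 0 ≤ a.β k / 2 * ‖P.c (x (k + 1))‖ ^ 2 := by
      have := Params.β_pos hβ hσ k
      positivity
    have hg := growth_nonneg hb hβ hσ hM hv
    have hfin : a.growth v D Bc BJ Bg * (1 + ε) * (k * ((k : ℝ) + 1) ^ (a.q + 1)) +
        a.growth v D Bc BJ Bg * ((1 + ε) * ((k : ℝ) + 1) ^ (a.q + 1)) ≤
        a.growth v D Bc BJ Bg * (1 + ε) *
          (((k + 1 : ℕ) : ℝ) * (((k + 1 : ℕ) : ℝ) + 1) ^ (a.q + 1)) := by
      rw [mul_assoc (a.growth v D Bc BJ Bg), mul_assoc (a.growth v D Bc BJ Bg), ← mul_add]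
      refine mul_le_mul_of_nonneg_left ?_ hg
      rw [← mul_add]
      refine mul_le_mul_of_nonneg_left ?_ (by linarith)
      push_cast
      have : ((k : ℝ) + 1) ^ (a.q + 1) ≤ ((k : ℝ) + 1 + 1) ^ (a.q + 1) := by gcongr; linarith
      have hk1 : (0 : ℝ) ≤ (k : ℝ) + 1 := by positivity
      nlinarith
    linarith

lemma smoothAL_ge (hb : DomBounds P D Bc BJ Bg m) {β : ℝ} (hβ : 0 ≤ β) (y : Vec l) {z : Vec n}
    (hz : z ∈ P.dom) : m - Bc * ‖y‖ ≤ P.smoothAL β y z + P.h z := by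
  have h1 := hb.le_value z hz
  have h2 := (abs_le.mp (abs_real_inner_le_norm y (P.c z))).1
  have h3 := mul_le_mul_of_nonneg_left (hb.c_le z hz) (norm_nonneg y)
  have h4 : 0 ≤ β / 2 * ‖P.c z‖ ^ 2 := by positivity
  rw [Problem.smoothAL]
  linarith

/-- This is the initial gap that controls the number of proximal steps; `F` enters only through `|F
- m|`. -/
lemma gap_le (h : IsRun P κ a ε x₀ start K x y N) (hP : P.Standing κ)
    (hU : P.Admissible κ U) (hb : DomBounds P D Bc BJ Bg m) (hβ : 0 < a.β₀) (hσ : 1 < a.σ)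
    (hM : 0 < a.M) (hv : 0 < v) (hρ : 0 < κ.ρ₀ + a.β₀ * κ.ρc) (hε : 0 < ε) (hx₀ : x₀ ∈ P.dom)
    (hreg : ∀ k < K, P.RegularAt v (a.β k) (x (k + 1))) (hF : P.g x₀ + P.h x₀ ≤ F) {k : ℕ}
    (hk : k ≤ K) :
    P.smoothAL (a.β k) (y k) (x k) + P.h (x k) - (m - Bc * ‖y k‖) ≤
      (|F - m| + a.growth v D Bc BJ Bg) * (1 + ε) * ((k : ℝ) + 1) ^ (a.q + 2) := by
  have h1 := h.value_le hP hU hb hβ hσ hM hv hρ hε hx₀ hreg hF hk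
  have h2 := h.penalty_le hP hU hb hβ hσ hM hv hρ hε hx₀ hreg hk
  have h3 := (abs_le.mp (abs_real_inner_le_norm (y k) (P.c (x k)))).2
  have h4 := mul_le_mul_of_nonneg_left (hb.c_le _ (h.mem_dom hx₀ hk)) (norm_nonneg (y k))
  have h5 := mul_nonneg hε.le hb.D_nonneg
  have h6 : |F - m| * 1 ≤ |F - m| * ((1 + ε) * ((k : ℝ) + 1) ^ (a.q + 2)) := by
    refine mul_le_mul_of_nonneg_left ?_ (abs_nonneg _)
    exact one_le_mul_of_one_le_of_one_le (by linarith)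
      (one_le_pow₀ (by linarith [k.cast_nonneg (α := ℝ)]))
  have h7 := le_abs_self (F - m)
  have e : ((k : ℝ) + 1) ^ (a.q + 2) = ((k : ℝ) + 1) * ((k : ℝ) + 1) ^ (a.q + 1) := pow_succ' _ _
  rw [Problem.smoothAL]
  rw [e] at h6 ⊢
  linarith

lemma card_le (h : IsRun P κ a ε x₀ start K x y N) (hP : P.Standing κ)
    (hU : P.Admissible κ U) (hb : DomBounds P D Bc BJ Bg m) (hβ : 0 < a.β₀) (hσ : 1 < a.σ)
    (hM : 0 < a.M) (hv : 0 < v) (hρ : 0 < κ.ρ₀ + a.β₀ * κ.ρc) (hε : 0 < ε) (hx₀ : x₀ ∈ P.dom)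
    (hstart : ∀ k j, start k j ∈ P.dom)
    (hreg : ∀ k < K, P.RegularAt v (a.β k) (x (k + 1))) (hF : P.g x₀ + P.h x₀ ≤ F) {k : ℕ}
    (hk : k < K) {ρ Lφ : ℝ} (hρk : ρ = κ.ρhat (a.β k) (y k)) (hLk : Lφ = κ.Lhat (a.β k) (y k)) :
    (N k : ℝ) ≤ (1 + 32 * ρ * ((|F - m| + a.growth v D Bc BJ Bg) * (1 + ε) *
        ((k : ℝ) + 1) ^ (a.q + 2)) / ε ^ 2) *
      (3 + Real.sqrt ((Lφ + 2 * ρ) / ρ) *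
        Real.log (1 + 64 * (Lφ + 2 * ρ) ^ 3 * D ^ 2 / (ρ * (ε / 4) ^ 2))) := by
  have hβk := (Params.β_pos hβ hσ k).le
  have hρ0 := hρ.trans_le (κ.le_ρhat hP hU.bounds (Params.le_β hβ hσ k) (y k))
  have hL0 := κ.Lhat_nonneg hP hU.bounds hβk (y k)
  have h1 := (h.x_step k hk).card_le hP hU (hU.quadModel hP hβk (y k)) hρ0 hL0 hε hb.diam
    (fun z hz => smoothAL_ge hb hβk (y k) hz) (h.mem_dom hx₀ hk.le) (hstart k)
  have h2 := h.gap_le hP hU hb hβ hσ hM hv hρ hε hx₀ hreg hF hk.le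
  subst hρk hLk
  refine h1.trans (mul_le_mul_of_nonneg_right ?_ ?_)
  · gcongr
  · refine add_nonneg (by norm_num) (mul_nonneg (Real.sqrt_nonneg _) (Real.log_nonneg ?_))
    have : 0 ≤ 64 * (κ.Lhat (a.β k) (y k) + 2 * κ.ρhat (a.β k) (y k)) ^ 3 * D ^ 2 /
      (κ.ρhat (a.β k) (y k) * (ε / 4) ^ 2) := by positivity
    linarith

end IsRun

lemma Problem.Standing.exists_isRun (hP : P.Standing κ) (hU : P.Admissible κ U) (hβ : 0 < a.β₀)
    (hσ : 1 < a.σ) (hρ : 0 < κ.ρ₀ + a.β₀ * κ.ρc) (hε : 0 < ε) (hx₀ : x₀ ∈ P.dom)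
    (hstart : ∀ k j, start k j ∈ P.dom) (K : ℕ) :
    ∃ x y N, IsRun P κ a ε x₀ start K x y N := by
  -- Outputs are bundled with membership in the domain, because the next call needs a feasible
  -- starting point to terminate.
  have hex : ∀ (k : ℕ) (y : Vec l) (z : P.dom), ∃ (N : ℕ) (out : P.dom),
      P.IPPMOutputs (P.smoothAL (a.β k) y) z (κ.ρhat (a.β k) y) (κ.Lhat (a.β k) y) ε (start k) N
        out := fun k y z => by
    have hβk := (Params.β_pos hβ hσ k).le
    obtain ⟨N, out, h⟩ := hP.exists_IPPMOutputs hU (hU.quadModel hP hβk y)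
      (hρ.trans_le (κ.le_ρhat hP hU.bounds (Params.le_β hβ hσ k) y))
      (κ.Lhat_nonneg hP hU.bounds hβk y) hε z.2 (hstart k)
    exact ⟨N, ⟨out, h.mem_dom⟩, h⟩
  choose N out hout using hex
  let st : ℕ → P.dom × Vec l := fun k => Nat.rec (⟨x₀, hx₀⟩, 0) (fun k s =>
    (out k s.2 s.1, s.2 + (a.M * ((k : ℝ) + 1) ^ a.q / ‖P.c (out k s.2 s.1)‖) •
      P.c (out k s.2 s.1))) k
  exact ⟨fun k => (st k).1, fun k => (st k).2, fun k => N k (st k).2 (st k).1, rfl, rfl,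
    fun k _ => hout k (st k).2 (st k).1, fun k _ => rfl⟩

end IALM

namespace IALM

/-! ### Calculus of bounds up to logarithmic factors. -/

section Polylog

lemma one_le_one_add_inv {e : ℝ} (he : 0 < e) : 1 ≤ 1 + e⁻¹ := by
  have := inv_pos.mpr he
  linarith

lemma one_le_one_add_abs_log (e : ℝ) : 1 ≤ 1 + |Real.log e| := by
  have := abs_nonneg (Real.log e)
  linarith

lemma log_one_add_inv_le {e : ℝ} (he : 0 < e) : Real.log (1 + e⁻¹) ≤ 1 + |Real.log e| := by
  have h2 : Real.log 2 ≤ 1 := by linarith [Real.log_two_lt_d9]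
  rcases le_total 1 e with h | h
  · have h1 : 1 + e⁻¹ ≤ 2 := by linarith [inv_le_one_of_one_le₀ h]
    have := Real.log_le_log (by positivity) h1
    linarith [abs_nonneg (Real.log e)]
  · have h1 : 1 + e⁻¹ ≤ 2 * e⁻¹ := by linarith [(one_le_inv₀ he).mpr h]
    have h3 := Real.log_le_log (by positivity) h1
    rw [Real.log_mul (by norm_num) (by positivity), Real.log_inv] at h3
    linarith [neg_le_abs (Real.log e)]

/-- The calculus uses the base `1 + 1/ε`, which is at least `1` for every `ε > 0`, so exponents can
be raised freely; this converts back to powers of `ε`. -/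
lemma one_add_inv_rpow_le {e r : ℝ} (he : 0 < e) (hr : 0 ≤ r) :
    (1 + e⁻¹) ^ r ≤ 2 ^ r * (1 + e ^ (-r)) := by
  have hpos : 0 < e ^ (-r) := Real.rpow_pos_of_pos he _
  have h2 : (0 : ℝ) < 2 ^ r := by positivity
  rcases le_total 1 e with h | h
  · have h1 : 1 + e⁻¹ ≤ 2 := by linarith [inv_le_one_of_one_le₀ h]
    have h3 := Real.rpow_le_rpow (by positivity) h1 hr
    nlinarith
  · have h1 : 1 + e⁻¹ ≤ 2 * e⁻¹ := by linarith [(one_le_inv₀ he).mpr h]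
    have h3 := Real.rpow_le_rpow (by positivity) h1 hr
    rw [Real.mul_rpow (by norm_num) (by positivity), Real.inv_rpow he.le,
      ← Real.rpow_neg he.le] at h3
    nlinarith

/-- `f = Õ((1 + 1/ε)^r)`, uniformly over a family of instances indexed by `ι`. -/
def PolylogLE {ι : Type*} (ε : ι → ℝ) (r : ℝ) (f : ι → ℝ) : Prop :=
  ∃ (C : ℝ) (p : ℕ), 0 ≤ C ∧ ∀ i, f i ≤ C * (1 + (ε i)⁻¹) ^ r * (1 + |Real.log (ε i)|) ^ p

namespace PolylogLE

variable {ι : Type*} {ε : ι → ℝ} {r s : ℝ} {f g : ι → ℝ}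

lemma of_le (hg : PolylogLE ε r g) (h : ∀ i, f i ≤ g i) : PolylogLE ε r f := by
  obtain ⟨C, p, hC, hb⟩ := hg
  exact ⟨C, p, hC, fun i => (h i).trans (hb i)⟩

lemma mono (hε : ∀ i, 0 < ε i) (hf : PolylogLE ε r f) (h : r ≤ s) : PolylogLE ε s f := by
  obtain ⟨C, p, hC, hb⟩ := hf
  refine ⟨C, p, hC, fun i => (hb i).trans ?_⟩
  have := Real.rpow_le_rpow_of_exponent_le (one_le_one_add_inv (hε i)) h
  gcongr

lemma const (c : ℝ) : PolylogLE ε 0 fun _ : ι => c :=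
  ⟨|c|, 0, abs_nonneg c, fun i => by simpa using le_abs_self c⟩

lemma inv : PolylogLE ε 1 fun i => (ε i)⁻¹ :=
  ⟨1, 0, zero_le_one, fun i => by simp⟩

lemma add (hε : ∀ i, 0 < ε i) (hf : PolylogLE ε r f) (hg : PolylogLE ε r g) :
    PolylogLE ε r fun i => f i + g i := by
  obtain ⟨C, p, hC, hb⟩ := hf
  obtain ⟨C', p', hC', hb'⟩ := hg
  refine ⟨C + C', p + p', by positivity, fun i => ?_⟩
  have hl := one_le_one_add_abs_log (ε i)
  have hE : 0 ≤ (1 + (ε i)⁻¹) ^ r := Real.rpow_nonneg (by linarith [one_le_one_add_inv (hε i)]) _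
  have h1 : (1 + |Real.log (ε i)|) ^ p ≤ (1 + |Real.log (ε i)|) ^ (p + p') :=
    pow_le_pow_right₀ hl (by omega)
  have h2 : (1 + |Real.log (ε i)|) ^ p' ≤ (1 + |Real.log (ε i)|) ^ (p + p') :=
    pow_le_pow_right₀ hl (by omega)
  have h3 := mul_le_mul_of_nonneg_left h1 (mul_nonneg hC hE)
  have h4 := mul_le_mul_of_nonneg_left h2 (mul_nonneg hC' hE)
  have := hb i
  have := hb' i
  linarith

lemma mul (hε : ∀ i, 0 < ε i) (hf : PolylogLE ε r f) (hg : PolylogLE ε s g)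
    (hg0 : ∀ i, 0 ≤ g i) : PolylogLE ε (r + s) fun i => f i * g i := by
  obtain ⟨C, p, hC, hb⟩ := hf
  obtain ⟨C', p', hC', hb'⟩ := hg
  refine ⟨C * C', p + p', by positivity, fun i => ?_⟩
  have hE : 0 < 1 + (ε i)⁻¹ := by linarith [one_le_one_add_inv (hε i)]
  have h1 := mul_le_mul_of_nonneg_right (hb i) (hg0 i)
  have h2 := mul_le_mul_of_nonneg_left (hb' i)
    (show 0 ≤ C * (1 + (ε i)⁻¹) ^ r * (1 + |Real.log (ε i)|) ^ p by positivity)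
  rw [Real.rpow_add hE, pow_add]
  refine (h1.trans h2).trans (le_of_eq ?_)
  ring

lemma const_mul (hε : ∀ i, 0 < ε i) {c : ℝ} (hg : PolylogLE ε s g) (hg0 : ∀ i, 0 ≤ g i) :
    PolylogLE ε s fun i => c * g i := by
  simpa using (const (ε := ε) c).mul hε hg hg0

lemma pow (hε : ∀ i, 0 < ε i) (hf : PolylogLE ε r f) (hf0 : ∀ i, 0 ≤ f i) (k : ℕ) :
    PolylogLE ε (k * r) fun i => f i ^ k := by
  induction k with
  | zero => simpa using const (ε := ε) 1
  | succ k ih =>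
    have := ih.mul hε hf hf0
    simp only [pow_succ]
    push_cast
    rwa [add_mul, one_mul]

lemma sqrt (hε : ∀ i, 0 < ε i) (hf : PolylogLE ε r f) :
    PolylogLE ε (r / 2) fun i => Real.sqrt (f i) := by
  obtain ⟨C, p, hC, hb⟩ := hf
  refine ⟨C + 1, p, by positivity, fun i => ?_⟩
  have hE : 0 < 1 + (ε i)⁻¹ := by linarith [one_le_one_add_inv (hε i)]
  have hl := one_le_one_add_abs_log (ε i)
  refine Real.sqrt_le_iff.mpr ⟨by positivity, (hb i).trans ?_⟩
  have e : ((C + 1) * (1 + (ε i)⁻¹) ^ (r / 2) * (1 + |Real.log (ε i)|) ^ p) ^ 2 =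
      (C + 1) ^ 2 * (1 + (ε i)⁻¹) ^ r * ((1 + |Real.log (ε i)|) ^ p * (1 + |Real.log (ε i)|) ^ p) := by
    have : (1 + (ε i)⁻¹) ^ r = (1 + (ε i)⁻¹) ^ (r / 2) * (1 + (ε i)⁻¹) ^ (r / 2) := by
      rw [← Real.rpow_add hE, add_halves]
    rw [this]
    ring
  rw [e]
  have h1 : C ≤ (C + 1) ^ 2 := by nlinarith
  have h2 : (1 + |Real.log (ε i)|) ^ p ≤ (1 + |Real.log (ε i)|) ^ p * (1 + |Real.log (ε i)|) ^ p :=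
    le_mul_of_one_le_right (by positivity) (one_le_pow₀ hl)
  gcongr

/-- A power of `1 + 1/ε` inside a logarithm costs only one factor `1 + |log ε|`, so the exponent
drops to `0`. -/
lemma log_one_add (hε : ∀ i, 0 < ε i) (hf : PolylogLE ε r f) (hf0 : ∀ i, 0 ≤ f i) (hr : 0 ≤ r) :
    PolylogLE ε 0 fun i => Real.log (1 + f i) := by
  obtain ⟨C, p, hC, hb⟩ := hf
  have hlC : 0 ≤ Real.log (1 + C) := Real.log_nonneg (by linarith)
  refine ⟨Real.log (1 + C) + r + p, 1, by positivity, fun i => ?_⟩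
  have hE := one_le_one_add_inv (hε i)
  have hl := one_le_one_add_abs_log (ε i)
  have hEr : 1 ≤ (1 + (ε i)⁻¹) ^ r := Real.one_le_rpow hE hr
  have hlp : 1 ≤ (1 + |Real.log (ε i)|) ^ p := one_le_pow₀ hl
  have h1 : 1 + f i ≤ (1 + C) * (1 + (ε i)⁻¹) ^ r * (1 + |Real.log (ε i)|) ^ p := by
    have := one_le_mul_of_one_le_of_one_le hEr hlp
    have := hb i
    linarith
  have h2 := Real.log_le_log (by linarith [hf0 i]) h1
  rw [Real.log_mul (by positivity) (by positivity), Real.log_mul (by positivity) (by positivity),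
    Real.log_rpow (by positivity), Real.log_pow] at h2
  have h3 := mul_le_mul_of_nonneg_left (log_one_add_inv_le (hε i)) hr
  have h4 := mul_le_mul_of_nonneg_left
    (Real.log_le_self (by linarith : 0 ≤ 1 + |Real.log (ε i)|)) p.cast_nonneg
  have h5 := le_mul_of_one_le_right hlC hl
  rw [Real.rpow_zero, mul_one, pow_one]
  linarith

end PolylogLE

end Polylog

/-! ### How many outer iterations reach feasibility. -/

section OuterIterations

lemma exists_pow_le_mul_pow (q : ℕ) {τ : ℝ} (hτ : 1 < τ) :
    ∃ C : ℝ, 0 < C ∧ ∀ k : ℕ, (k : ℝ) ^ q ≤ C * τ ^ k := by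
  obtain ⟨C, hC⟩ := (tendsto_pow_const_div_const_pow_of_one_lt q hτ).bddAbove_range
  refine ⟨|C| + 1, by positivity, fun k => ?_⟩
  have h1 : (k : ℝ) ^ q / τ ^ k ≤ C := hC ⟨k, rfl⟩
  rw [div_le_iff₀ (by positivity)] at h1
  refine h1.trans ?_
  have := le_abs_self C
  gcongr
  linarith

/-- The number of outer iterations that suffices for tolerance `ε`. -/
lemma exists_outer_count {β₀ σ v A : ℝ} (hβ : 0 < β₀) (hσ : 1 < σ) (hv : 0 < v) (hA : 0 ≤ A)
    (q : ℕ) : ∃ (K : ℝ → ℕ) (C : ℝ), ∀ ε, 0 < ε → 0 < K ε ∧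
      ε + A * (K ε : ℝ) ^ q ≤ v * (β₀ * σ ^ (K ε - 1)) * ε ∧
      β₀ * σ ^ (K ε - 1) ≤ C * (1 + ε⁻¹) * (K ε : ℝ) ^ q ∧ (K ε : ℝ) ≤ C * (1 + |Real.log ε|) := by
  classical
  have hσ0 : 0 < σ := by linarith
  -- Splitting `σ^k = τ^k τ^k` lets one factor absorb the polynomial while the other still grows.
  set τ := Real.sqrt σ with hτ
  have hτ1 : 1 < τ := by rw [hτ, Real.lt_sqrt (by norm_num)]; simpa using hσ
  have hτσ : τ * τ = σ := Real.mul_self_sqrt hσ0.le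
  have hτ0 : 0 < τ := by linarith
  obtain ⟨C₃, hC₃, hpow⟩ := exists_pow_le_mul_pow q hτ1
  have hex : ∀ ε : ℝ, ∃ k : ℕ, 0 < ε → ε + A * ((k + 1 : ℕ) : ℝ) ^ q ≤ v * (β₀ * σ ^ k) * ε := by
    intro ε
    by_cases hε : 0 < ε
    · obtain ⟨k, hk⟩ := pow_unbounded_of_one_lt ((ε + A * (C₃ * τ)) / (v * β₀ * ε)) hτ1
      refine ⟨k, fun _ => ?_⟩
      rw [div_lt_iff₀ (by positivity)] at hk
      have h1 := mul_le_mul_of_nonneg_left (hpow (k + 1)) hA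
      have h2 : ε ≤ ε * τ ^ k := le_mul_of_one_le_right hε.le (one_le_pow₀ hτ1.le)
      have h3 := mul_le_mul_of_nonneg_left hk.le (by positivity : 0 ≤ τ ^ k)
      rw [pow_succ] at h1
      rw [← hτσ, mul_pow]
      linarith
    · exact ⟨0, fun h => absurd h hε⟩
  set C₁ := β₀ + σ * (1 + A) / v with hC₁
  have hC₁0 : 0 < C₁ := by positivity
  set C₄ := σ * C₁ * C₃ / β₀ with hC₄
  have hC₄0 : 0 < C₄ := by positivity
  have hlτ : 0 < Real.log τ := Real.log_pos hτ1
  set C₂ := (|Real.log C₄| + 1) / Real.log τ with hC₂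
  -- The least admissible index is taken: failure of the inequality one step earlier bounds the
  -- final penalty from above.
  refine ⟨fun ε => Nat.find (hex ε) + 1, max C₁ C₂, fun ε hε => ?_⟩
  have hE := one_le_one_add_inv hε
  have hl := one_le_one_add_abs_log ε
  set k := Nat.find (hex ε) with hk
  have hβle : β₀ * σ ^ k ≤ C₁ * (1 + ε⁻¹) * ((k + 1 : ℕ) : ℝ) ^ q := by
    rcases hk0 : k with _ | j
    · have : C₁ ≤ C₁ * (1 + ε⁻¹) := le_mul_of_one_le_right hC₁0.le hE
      have : 0 ≤ σ * (1 + A) / v := by positivity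
      simp
      linarith
    · have h1 := Nat.find_min (hex ε) (m := j) (by omega)
      push Not at h1
      have h2 := h1.2
      have h3 : (((j + 1 : ℕ) : ℝ)) ^ q ≤ ((j + 1 + 1 : ℕ) : ℝ) ^ q := by
        gcongr; omega
      have h4 : (1 : ℝ) ≤ ((j + 1 + 1 : ℕ) : ℝ) ^ q := one_le_pow₀ (by push_cast; linarith [j.cast_nonneg (α := ℝ)])
      set X := ((j + 1 + 1 : ℕ) : ℝ) ^ q with hX
      have h5 : ε + A * ((j + 1 : ℕ) : ℝ) ^ q ≤ (1 + A) * X * (ε + 1) := by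
        have e1 := mul_le_mul_of_nonneg_left h3 hA
        have e2 : ε ≤ ε * X := le_mul_of_one_le_right hε.le h4
        have e3 : 0 ≤ X := by linarith
        nlinarith [mul_nonneg hA (mul_nonneg e3 hε.le)]
      have h6 : β₀ * σ ^ j ≤ (1 + A) * X * (1 + ε⁻¹) / v := by
        rw [le_div_iff₀ hv]
        have : (β₀ * σ ^ j * v) * ε ≤ ((1 + A) * X * (1 + ε⁻¹)) * ε := by
          have e : ((1 + A) * X * (1 + ε⁻¹)) * ε = (1 + A) * X * (ε + 1) := by field_simp
          rw [e]
          linarith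
        exact le_of_mul_le_mul_right this hε
      calc β₀ * σ ^ (j + 1) = σ * (β₀ * σ ^ j) := by rw [pow_succ]; ring
        _ ≤ σ * ((1 + A) * X * (1 + ε⁻¹) / v) := by gcongr
        _ = (σ * (1 + A) / v) * ((1 + ε⁻¹) * X) := by ring
        _ ≤ C₁ * ((1 + ε⁻¹) * X) := by
          gcongr
          linarith
        _ = C₁ * (1 + ε⁻¹) * X := by ring
  refine ⟨Nat.succ_pos _, Nat.find_spec (hex ε) hε, ?_, ?_⟩
  · rw [Nat.add_sub_cancel]
    refine hβle.trans ?_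
    gcongr
    exact le_max_left _ _
  -- Of the two factors `τ^(k+1)` in `σ^(k+1)`, one cancels against the polynomial bound; the
  -- logarithm of the rest bounds `K`.
  · have h1 : τ ^ (k + 1) ≤ C₄ * (1 + ε⁻¹) := by
      have e1 : β₀ * (τ ^ (k + 1) * τ ^ (k + 1)) = σ * (β₀ * σ ^ k) := by
        rw [← mul_pow, hτσ, pow_succ]; ring
      have e2 : β₀ * (τ ^ (k + 1) * τ ^ (k + 1)) ≤
          σ * (C₁ * (1 + ε⁻¹) * (C₃ * τ ^ (k + 1))) := by
        rw [e1]
        refine mul_le_mul_of_nonneg_left (hβle.trans ?_) hσ0.le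
        exact mul_le_mul_of_nonneg_left (hpow (k + 1)) (by positivity)
      have e3 : (C₄ * (1 + ε⁻¹)) * (β₀ * τ ^ (k + 1)) =
          σ * (C₁ * (1 + ε⁻¹) * (C₃ * τ ^ (k + 1))) := by
        rw [hC₄]; field_simp
      refine le_of_mul_le_mul_right ?_ (by positivity : 0 < β₀ * τ ^ (k + 1))
      rw [e3]
      linarith
    have h2 := Real.log_le_log (by positivity) h1
    rw [Real.log_pow, Real.log_mul (by positivity) (by positivity)] at h2
    have h3 := log_one_add_inv_le hε
    have h4 : |Real.log C₄| ≤ |Real.log C₄| * (1 + |Real.log ε|) :=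
      le_mul_of_one_le_right (abs_nonneg _) hl
    have h5 : ((k + 1 : ℕ) : ℝ) ≤ C₂ * (1 + |Real.log ε|) := by
      rw [hC₂, div_mul_eq_mul_div, le_div_iff₀ hlτ]
      linarith [le_abs_self (Real.log C₄)]
    refine h5.trans ?_
    gcongr
    exact le_max_right _ _

end OuterIterations

/-! ### Total complexity. -/

variable {n l : ℕ} {P : Problem n l} {κ : Constants l} {U : Set (Vec n)} {a : Params} {v F : ℝ}
  {K : ℝ → ℕ}

/-- An outer iteration `k` of a run with `K ε` outer iterations that satisfies the regularity
condition. -/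
structure RunIndex (P : Problem n l) (κ : Constants l) (a : Params) (v F : ℝ) (K : ℝ → ℕ) where
  ε : ℝ
  x₀ : Vec n
  start : ℕ → ℕ → Vec n
  x : ℕ → Vec n
  y : ℕ → Vec l
  N : ℕ → ℕ
  k : ℕ
  ε_pos : 0 < ε
  x₀_mem : x₀ ∈ P.dom
  value_le : P.g x₀ + P.h x₀ ≤ F
  start_mem : ∀ k j, start k j ∈ P.dom
  run : IsRun P κ a ε x₀ start (K ε) x y N
  regular : ∀ k < K ε, P.RegularAt v (a.β k) (x (k + 1))
  k_lt : k < K ε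

namespace RunIndex

/-- Here `s` is the growth exponent of `ρ̂` in `1/ε`. The exponent is `2` from the number of
proximal steps, plus `(s + 1)/2` from `√(ρ̂ L)`. Indexing by all runs at once makes the constants
uniform in `ε`, `x⁰` and the APG starting points. -/
lemma polylogLE_card (hP : P.Standing κ) (hU : P.Admissible κ U) (hβ : 0 < a.β₀) (hσ : 1 < a.σ)
    (hM : 0 < a.M) (hv : 0 < v) (hρ : 0 < κ.ρ₀ + a.β₀ * κ.ρc) {C s : ℝ}
    (hKβ : ∀ ε, 0 < ε → a.β (K ε - 1) ≤ C * (1 + ε⁻¹) * (K ε : ℝ) ^ (a.q + 1))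
    (hK : ∀ ε, 0 < ε → (K ε : ℝ) ≤ C * (1 + |Real.log ε|)) (hs : s ≤ 1)
    (hs' : 0 ≤ s) (hsρ : κ.ρc = 0 ∨ s = 1) :
    PolylogLE (fun i : RunIndex P κ a v F K => i.ε) (2 + (s + 1) / 2) fun i => (i.N i.k : ℝ) := by
  have hε : ∀ i : RunIndex P κ a v F K, 0 < i.ε := fun i => i.ε_pos
  obtain ⟨D, Bc, BJ, Bg, m, hb⟩ := hP.exists_domBounds hU.bounds
  have hg := IsRun.growth_nonneg hb hβ hσ hM hv
  have hKt : PolylogLE (fun i : RunIndex P κ a v F K => i.ε) 0 fun i => (K i.ε : ℝ) :=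
    ⟨|C|, 1, abs_nonneg C, fun i => by
      rw [Real.rpow_zero, mul_one, pow_one]
      exact (hK _ i.ε_pos).trans (mul_le_mul_of_nonneg_right (le_abs_self C)
        (by linarith [one_le_one_add_abs_log i.ε]))⟩
  have hKp : ∀ p : ℕ, PolylogLE (fun i : RunIndex P κ a v F K => i.ε) 0
      fun i => (K i.ε : ℝ) ^ p := fun p => by
    simpa using hKt.pow hε (fun i => Nat.cast_nonneg _) p
  have hy : PolylogLE (fun i : RunIndex P κ a v F K => i.ε) 0 fun i => ‖i.y i.k‖ := by
    refine ((hKp (a.q + 1)).const_mul hε (c := a.M) fun i => by positivity).of_le fun i => ?_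
    refine (i.run.norm_y_le hM.le i.k_lt.le).trans (mul_le_mul_of_nonneg_left ?_ hM.le)
    exact pow_le_pow_left₀ (Nat.cast_nonneg _) (by exact_mod_cast i.k_lt.le) _
  have hE : PolylogLE (fun i : RunIndex P κ a v F K => i.ε) 1 fun i => 1 + i.ε⁻¹ :=
    ((PolylogLE.const 1).mono hε zero_le_one).add hε PolylogLE.inv
  have hE0 : ∀ i : RunIndex P κ a v F K, 0 ≤ 1 + i.ε⁻¹ := fun i => by
    linarith [one_le_one_add_inv i.ε_pos]
  have hβt : PolylogLE (fun i : RunIndex P κ a v F K => i.ε) 1 fun i => a.β i.k := by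
    have h1 := (hE.mul hε (hKp (a.q + 1)) fun i => by positivity).const_mul hε (c := C)
      fun i => mul_nonneg (hE0 i) (by positivity)
    rw [add_zero] at h1
    refine h1.of_le fun i => ?_
    have h2 : a.β i.k ≤ a.β (K i.ε - 1) := by
      have := i.k_lt
      exact mul_le_mul_of_nonneg_left (pow_le_pow_right₀ hσ.le (by omega)) hβ.le
    rw [← mul_assoc]
    exact h2.trans (hKβ _ i.ε_pos)
  have hβ0 : ∀ i : RunIndex P κ a v F K, 0 ≤ a.β i.k := fun i => (Params.β_pos hβ hσ _).le
  set ρ : RunIndex P κ a v F K → ℝ := fun i => κ.ρhat (a.β i.k) (i.y i.k) with hρdef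
  set L : RunIndex P κ a v F K → ℝ := fun i => κ.Lhat (a.β i.k) (i.y i.k) + 2 * ρ i with hLdef
  set ρ₁ := κ.ρ₀ + a.β₀ * κ.ρc with hρ₁
  have hρle : ∀ i, ρ₁ ≤ ρ i := fun i => κ.le_ρhat hP hU.bounds (Params.le_β hβ hσ _) _
  have hρ0 : ∀ i, 0 < ρ i := fun i => hρ.trans_le (hρle i)
  have hL0 : ∀ i, 0 ≤ L i := fun i =>
    add_nonneg (κ.Lhat_nonneg hP hU.bounds (hβ0 i) _) (by linarith [hρ0 i])
  have hρt : PolylogLE (fun i : RunIndex P κ a v F K => i.ε) s ρ := by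
    have h1 := ((PolylogLE.const κ.ρ₀).add hε
      (hy.const_mul hε (c := κ.Lbar) fun i => norm_nonneg _)).mono hε hs'
    rcases hsρ with h | h
    · refine h1.of_le fun i => ?_
      simp [hρdef, Constants.ρhat, h]
    · subst h
      refine (h1.add hε (hβt.const_mul hε (c := κ.ρc) hβ0)).of_le fun i => ?_
      simp only [hρdef, Constants.ρhat]
      linarith
  have hLt : PolylogLE (fun i : RunIndex P κ a v F K => i.ε) 1 L := by
    have h1 := ((PolylogLE.const κ.L₀).add hε
      (hy.const_mul hε (c := κ.Lbar) fun i => norm_nonneg _)).mono hε zero_le_one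
    refine ((h1.add hε (hβt.const_mul hε (c := κ.Lc) hβ0)).add hε
      ((hρt.mono hε hs).const_mul hε (c := 2) fun i => (hρ0 i).le)).of_le fun i => ?_
    simp only [hLdef, Constants.Lhat]
    linarith
  set Λ : RunIndex P κ a v F K → ℝ := fun i =>
    Real.log (1 + 64 * L i ^ 3 * D ^ 2 / (ρ i * (i.ε / 4) ^ 2)) with hΛdef
  have hQ0 : ∀ i, 0 ≤ 64 * L i ^ 3 * D ^ 2 / (ρ i * (i.ε / 4) ^ 2) := fun i => by
    have := hL0 i
    have := hρ0 i
    positivity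
  have hΛ0 : ∀ i, 0 ≤ Λ i := fun i => Real.log_nonneg (by linarith [hQ0 i])
  have hi0 : ∀ i : RunIndex P κ a v F K, 0 ≤ i.ε⁻¹ := fun i => (inv_pos.mpr i.ε_pos).le
  have hΛ : PolylogLE (fun i : RunIndex P κ a v F K => i.ε) 0 Λ := by
    have h1 := ((hLt.pow hε hL0 3).mul hε (PolylogLE.inv.pow hε hi0 2)
      fun i => pow_nonneg (hi0 i) 2).const_mul hε (c := 1024 * D ^ 2 / ρ₁)
      fun i => mul_nonneg (pow_nonneg (hL0 i) 3) (pow_nonneg (hi0 i) 2)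
    refine PolylogLE.log_one_add hε (h1.of_le fun i => ?_) hQ0 (by norm_num)
    have e : 1024 * D ^ 2 / ρ₁ * (L i ^ 3 * i.ε⁻¹ ^ 2) =
        64 * L i ^ 3 * D ^ 2 / (ρ₁ * (i.ε / 4) ^ 2) := by
      have := i.ε_pos
      field_simp
      ring
    rw [e]
    have h2 := hL0 i
    have h3 := i.ε_pos
    have h4 := hρle i
    gcongr
  set Γ := |F - m| + a.growth v D Bc BJ Bg with hΓ
  have hΓ0 : 0 ≤ Γ := by positivity
  set W : RunIndex P κ a v F K → ℝ := fun i =>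
    Γ * (1 + i.ε) * ((i.k : ℝ) + 1) ^ (a.q + 2) / i.ε ^ 2 with hWdef
  have hW0 : ∀ i, 0 ≤ W i := fun i => by
    have := i.ε_pos
    positivity
  have hW : PolylogLE (fun i : RunIndex P κ a v F K => i.ε) 2 W := by
    have h1 := ((hE.pow hε hE0 2).mul hε (hKp (a.q + 2)) fun i => by positivity).const_mul hε
      (c := Γ) fun i => mul_nonneg (pow_nonneg (hE0 i) 2) (by positivity)
    norm_num at h1
    refine h1.of_le fun i => ?_
    have h2 := i.ε_pos
    have h3 : ((i.k : ℝ) + 1) ^ (a.q + 2) ≤ (K i.ε : ℝ) ^ (a.q + 2) :=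
      pow_le_pow_left₀ (by positivity) (by exact_mod_cast i.k_lt) _
    -- The factor `1 + ε`, relevant for large `ε`, is absorbed because `(1 + 1/ε)² = (1 + ε)²/ε²`.
    have h4 : (1 + i.ε) / i.ε ^ 2 ≤ (1 + i.ε⁻¹) ^ 2 := by
      have e : (1 + i.ε⁻¹) ^ 2 = (1 + i.ε) ^ 2 / i.ε ^ 2 := by field_simp; ring
      rw [e]
      gcongr
      nlinarith
    calc W i = Γ * ((1 + i.ε) / i.ε ^ 2 * ((i.k : ℝ) + 1) ^ (a.q + 2)) := by
          rw [hWdef]; ring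
      _ ≤ _ := by gcongr
  have hsq : PolylogLE (fun i : RunIndex P κ a v F K => i.ε) (1 / 2)
      fun i => Real.sqrt (L i / ρ i) := by
    have h1 := (hLt.const_mul hε (c := ρ₁⁻¹) hL0).sqrt hε
    refine h1.of_le fun i => Real.sqrt_le_sqrt ?_
    rw [← div_eq_inv_mul]
    exact div_le_div_of_nonneg_left (hL0 i) hρ (hρle i)
  have hsq' : PolylogLE (fun i : RunIndex P κ a v F K => i.ε) ((s + 1) / 2)
      fun i => Real.sqrt (ρ i * L i) := (hρt.mul hε hLt hL0).sqrt hε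
  have t1 : PolylogLE (fun i : RunIndex P κ a v F K => i.ε) (2 + (s + 1) / 2)
      fun _ => (3 : ℝ) := (PolylogLE.const 3).mono hε (by linarith)
  have t2 : PolylogLE (fun i : RunIndex P κ a v F K => i.ε) (2 + (s + 1) / 2)
      fun i => Real.sqrt (L i / ρ i) * Λ i := (hsq.mul hε hΛ hΛ0).mono hε (by linarith)
  have t3 : PolylogLE (fun i : RunIndex P κ a v F K => i.ε) (2 + (s + 1) / 2)
      fun i => 96 * (ρ i * W i) := ((hρt.mul hε hW hW0).const_mul hε
        fun i => mul_nonneg (hρ0 i).le (hW0 i)).mono hε (by linarith)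
  have t4 : PolylogLE (fun i : RunIndex P κ a v F K => i.ε) (2 + (s + 1) / 2)
      fun i => 32 * (W i * Real.sqrt (ρ i * L i) * Λ i) := by
    have := ((hW.mul hε hsq' fun i => Real.sqrt_nonneg _).mul hε hΛ hΛ0).const_mul hε (c := 32)
      fun i => mul_nonneg (mul_nonneg (hW0 i) (Real.sqrt_nonneg _)) (hΛ0 i)
    rwa [add_zero] at this
  -- The four terms come from expanding `(1 + 32 ρ W)(3 + √(L/ρ) Λ)` with `ρ √(L/ρ) = √(ρ L)`.
  refine (((t1.add hε t2).add hε t3).add hε t4).of_le fun i => ?_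
  have h := i.run.card_le hP hU hb hβ hσ hM hv hρ i.ε_pos i.x₀_mem i.start_mem i.regular
    i.value_le i.k_lt rfl rfl
  refine h.trans (le_of_eq ?_)
  have e1 : ρ i * Real.sqrt (L i / ρ i) = Real.sqrt (ρ i * L i) := by
    have h1 : ρ i * L i = ρ i ^ 2 * (L i / ρ i) := by
      have := (hρ0 i).ne'
      field_simp
    rw [h1, Real.sqrt_mul (sq_nonneg _), Real.sqrt_sq (hρ0 i).le]
  have e2 : 32 * κ.ρhat (a.β i.k) (i.y i.k) * (Γ * (1 + i.ε) * ((i.k : ℝ) + 1) ^ (a.q + 2)) /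
      i.ε ^ 2 = 32 * ρ i * W i := by
    rw [hWdef]; ring
  rw [e2, ← e1]
  change (1 + 32 * ρ i * W i) * (3 + Real.sqrt (L i / ρ i) * Λ i) = _
  ring

end RunIndex

lemma Problem.Standing.hasComplexity (hP : P.Standing κ) (hU : P.Admissible κ U)
    (hβ : 0 < a.β₀) (hσ : 1 < a.σ) (hM : 0 < a.M) (hv : 0 < v)
    (hρ : 0 < κ.ρ₀ + a.β₀ * κ.ρc) {s : ℝ} (hs : s ≤ 1) (hs' : 0 ≤ s)
    (hsρ : κ.ρc = 0 ∨ s = 1) : HasComplexity P κ a v (2 + (s + 1) / 2) := by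
  intro F
  obtain ⟨D, Bc, BJ, Bg, m, hb⟩ := hP.exists_domBounds hU.bounds
  have hBJ := hb.BJ_nonneg
  have hBg := hb.Bg_nonneg
  obtain ⟨K, C, hK⟩ := exists_outer_count hβ hσ hv
    (by positivity : 0 ≤ Bg + BJ * a.M) (a.q + 1)
  obtain ⟨C', p, hC', hN⟩ := RunIndex.polylogLE_card (F := F) hP hU hβ hσ hM hv hρ
    (fun ε hε => (hK ε hε).2.2.1) (fun ε hε => (hK ε hε).2.2.2) hs hs' hsρ
  refine ⟨C * C' * 2 ^ (2 + (s + 1) / 2), p + 1, fun ε hε x₀ hx₀ hF start hstart hreg => ?_⟩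
  obtain ⟨hK0, hKv, -, hKC⟩ := hK ε hε
  refine ⟨K ε, hK0, hP.exists_isRun hU hβ hσ hρ hε hx₀ hstart (K ε), fun x y N hrun => ⟨?_, ?_⟩⟩
  · have hr := hreg _ _ _ _ hrun
    have h1 : ∀ k ∈ Finset.range (K ε), (N k : ℝ) ≤
        C' * (1 + ε⁻¹) ^ (2 + (s + 1) / 2) * (1 + |Real.log ε|) ^ p := fun k hk =>
      hN ⟨ε, x₀, start, x, y, N, k, hε, hx₀, hF, hstart, hrun, hr, Finset.mem_range.mp hk⟩
    have h2 := Finset.sum_le_sum h1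
    rw [Finset.sum_const, Finset.card_range, nsmul_eq_mul] at h2
    push_cast
    refine h2.trans ?_
    have h3 := one_add_inv_rpow_le hε (by linarith : 0 ≤ 2 + (s + 1) / 2)
    have hE := one_le_one_add_inv hε
    have hl := one_le_one_add_abs_log ε
    have hCl : 0 ≤ C * (1 + |Real.log ε|) := (Nat.cast_nonneg _).trans hKC
    calc (K ε : ℝ) * (C' * (1 + ε⁻¹) ^ (2 + (s + 1) / 2) * (1 + |Real.log ε|) ^ p)
        ≤ (C * (1 + |Real.log ε|)) *
          (C' * (2 ^ (2 + (s + 1) / 2) * (1 + ε ^ (-(2 + (s + 1) / 2)))) *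
            (1 + |Real.log ε|) ^ p) := by gcongr
      _ = _ := by rw [pow_succ]; ring
  · obtain ⟨k, hk⟩ := Nat.exists_eq_succ_of_ne_zero hK0.ne'
    rw [hk] at hrun hKv ⊢
    have hlt : k < k.succ := Nat.lt_succ_self k
    -- The defining inequality of `K ε`, with `A = Bg + BJ M`, dominates the right-hand side of
    -- `norm_c_le` and so forces `‖c(x^K)‖ ≤ ε`.
    refine hrun.isKKT hP hU hβ hσ hρ hε hlt ?_
    have h1 := hrun.norm_c_le hP hU hb hβ hσ hρ hε hx₀ hlt (hreg _ _ _ _ hrun k hlt)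
    have h2 := hrun.norm_y_le hM.le hlt.le
    have h3 : BJ * ‖y k‖ ≤ BJ * (a.M * ((k.succ : ℕ) : ℝ) ^ (a.q + 1)) := by
      refine mul_le_mul_of_nonneg_left (h2.trans ?_) hBJ
      have : (k : ℝ) ≤ (k.succ : ℕ) := by exact_mod_cast hlt.le
      gcongr
    have h4 : Bg ≤ Bg * ((k.succ : ℕ) : ℝ) ^ (a.q + 1) :=
      le_mul_of_one_le_right hBg (one_le_pow₀ (by exact_mod_cast Nat.succ_pos k))
    have hpos : 0 < v * a.β k := mul_pos hv (Params.β_pos hβ hσ k)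
    refine le_of_mul_le_mul_left ?_ hpos
    refine le_trans ?_ hKv
    linarith

end IALM

end

theorem mainTheorem2 {n l : ℕ} (P : IALM.Problem n l) (κ : IALM.Constants l) (a : IALM.Params)
    (v : ℝ) (hP : P.Standing κ) (hβ : 0 < a.β₀) (hσ : 1 < a.σ) (hM : 0 < a.M) (hv : 0 < v)
    (hρ : 0 < κ.ρ₀ + a.β₀ * κ.ρc) :
    -- polynomial growth of the multipliers
    (∃ C : ℝ, ∀ (ε : ℝ) (x₀ : IALM.Vec n) (start : ℕ → ℕ → IALM.Vec n) (K : ℕ)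
      (x : ℕ → IALM.Vec n) (y : ℕ → IALM.Vec l) (N : ℕ → ℕ),
      IALM.IsRun P κ a ε x₀ start K x y N → ∀ k ≤ K, ‖y k‖ ≤ C * (k : ℝ) ^ (a.q + 1)) ∧
    -- general constraints
    ((∀ i, IALM.IsWeaklyConvex (κ.ρ i) (fun x => -(P.c x i))) → P.BoundsOn κ P.extrapolated →
      IALM.HasComplexity P κ a v 3) ∧
    -- affine constraints
    ((∃ (A : IALM.Vec n →L[ℝ] IALM.Vec l) (b : IALM.Vec l), ∀ x, P.c x = A x - b) →
      (∀ i, κ.ρ i = 0) → P.BoundsOn κ P.dom → IALM.HasComplexity P κ a v (5 / 2)) := by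
  refine ⟨⟨a.M, fun ε x₀ start K x y N h k hk => h.norm_y_le hM.le hk⟩, fun hw hB => ?_,
    fun hA hρ0 hB => ?_⟩
  -- The exponent `2 + (s + 1)/2` equals `3` for `s = 1`, and `5/2` for `s = 0` in the affine case,
  -- where `ρ_c = 0`.
  · have h := hP.hasComplexity (hP.admissible_extrapolated hw hB) hβ hσ hM hv hρ (s := 1) le_rfl
      zero_le_one (Or.inr rfl)
    norm_num at h
    exact h
  · have h := hP.hasComplexity (hP.admissible_univ hA hρ0 hB) hβ hσ hM hv hρ (s := 0) zero_le_one
      le_rfl (Or.inl (by simp [IALM.Constants.ρc, hρ0]))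
    norm_num at h
    exact h
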